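/- **Setting.** Let $\sigma:\mathbb R\to\mathbb R$ be real analytic, monotonically increasing and $1$-Lipschitz, with a finite limit at $-\infty$ and a finite or infinite limit at $+\infty$. For $H\ge 2$ and layer sizes $m_0,\dots,m_{H+1}$ let $f(x,\theta)=W^{(H+1)}x^{(H)}+b^{(H+1)}$, where $x^{(0)}=x\in\mathbb R^{m_0}$ and $x^{(l)}=\frac1{\sqrt{m_l}}\sigma(W^{(l)}x^{(l-1)}+b^{(l)})$ for $1\le l\le H$ ($\sigma$ acts coordinatewise); $\theta$ collects all $\bar W^{(l)}=[W^{(l)},b^{(l)}]$. Write $m_y=m_{H+1}\ge 2$. The initial vector $\theta^0$ has independent entries, weights $\mathcal N(0,c_w)$ and biases $\mathcal N(0,c_b)$. The data $(x,y)$ follow a distribution with $\|x\|_2=1$ almost surely and $y\in\{0,1\}^{m_y}$ one-hot with $y_{j(y)}=1$; the sample $(x_i,y_i)_{i=1}^n$ is i.i.d. from it and independent of $\theta^0$. The criterion $\ell(\cdot,y)\ge0$ is, for every one-hot $y$, differentiable and convex with $\zeta$-Lipschitz gradient ($\zeta>0$), and $J(\theta)=\frac1n\sum_{i=1}^n\ell(f(x_i,\theta),y_i)$.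 Gradient descent is $\theta^{t+1}=\theta^t-\eta\odot\nabla J(\theta^t)$, where $\eta$ equals $\frac1{c_z\zeta}$, for some $c_z>0$, at the entries of $\bar W^{(H+1)}$, and $0$ at all other entries. Let $\bar W^t$ be the output-layer matrix $\bar W^{(H+1)}$ of $\theta^t$, and let $\|(\bar W^t)^\top\|_{2,\infty}$ be the largest Euclidean norm of a column of $(\bar W^t)^\top$, i.e. of a row of $\bar W^t$. Let $\ell_{01}(q,y)=0$ if $j(y)$ is the unique maximizer of $j\mapsto q_j$, and $\ell_{01}(q,y)=1$ otherwise; for $\rho>0$ let $\ell_\rho(q,y)=\min(\max(1-(q_{j(y)}-\max_{j\ne j(y)}q_j)/\rho,\,0),\,1)$. **Proposition.** For all such $\sigma$, all $c_w,c_b\ge0$ and every $C>0$ there are constants $c_H>0$ ($H\ge2$), depending only on $\sigma,c_w,c_b,C$ and $H$, and not depending on $H$ if $c_w<2$ or $\sigma$ is bounded, such that the following holds. Let $n\ge1$, $H\ge 2$, $\delta>0$, and let the layer sizes satisfy $$m_l\ge C H^2\log\tfrac{Hn^2}{\delta}\ (1\le l\le H-2),\qquad m_{H-1}\ge C\log\tfrac{Hn^2}{\delta},\qquad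 m_H\ge Cn .$$ Then, for every data distribution, $\ell$, $\zeta$, $c_z$ as above, and all $\rho>0$, $\varsigma\ge1$ and $\delta'>0$, with probability at least $1-\delta-\delta'$ over $\theta^0$ and $(x_i,y_i)_{i=1}^n$, for all $t\ge 0$, $$\mathbb E_{(x,y)}[\ell_{01}(f(x,\theta^t),y)]-\frac1n\sum_{i=1}^n\ell_\rho(f(x_i,\theta^t),y_i)\le\frac{c_H\,m_y^2\,\lceil\varsigma\|(\bar W^t)^\top\|_{2,\infty}\rceil}{\rho\,\varsigma\sqrt n}+\sqrt{\frac{1}{2n}\ln\frac{\pi^2\lceil\varsigma\|(\bar W^t)^\top\|_{2,\infty}\rceil^2}{\delta'}} .$$ (The expectation is over a fresh $(x,y)$, with $\theta^t$ fixed. The square root is read as $0$ if $\bar W^t=0$ or if the logarithm is negative.) -/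

import Mathlib

open MeasureTheory ProbabilityTheory Filter Topology

noncomputable section

/-- Activation units: real analytic, monotonically increasing, `1`-Lipschitz, with a finite limit at
`-∞` and a finite or infinite limit (`σ₊ ≤ +∞`) at `+∞`. -/
structure IsActivation (σ : ℝ → ℝ) : Prop where
  analytic : AnalyticOnNhd ℝ σ Set.univ
  mono : Monotone σ
  lipschitz : LipschitzWith 1 σ
  limBot : ∃ s : ℝ, Tendsto σ atBot (𝓝 s)
  limTop : (∃ s : ℝ, Tendsto σ atTop (𝓝 s)) ∨ Tendsto σ atTop atTop

/-- Indices of the trainable parameters of a network with `H` hidden layers and layer sizes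
`m 0` (input), `m 1, …, m H` (hidden), `m (H + 1)` (output).
`⟨l, i, some j⟩` is the weight `W^{(l+1)}_{ij}`, and `⟨l, i, none⟩` is the bias `b^{(l+1)}_i`. -/
abbrev ParamIdx (H : ℕ) (m : ℕ → ℕ) : Type :=
  Σ l : Fin (H + 1), Fin (m (l + 1)) × Option (Fin (m l))

/-- The space `ℝ^d` of parameter vectors `θ`. -/
abbrev Params (H : ℕ) (m : ℕ → ℕ) : Type := EuclideanSpace ℝ (ParamIdx H m)

/-- The output `x^{(l)}` of layer `l`:
`x^{(0)} = x` and `x^{(l)} = σ(W^{(l)} x^{(l-1)} + b^{(l)}) / √m_l`. -/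
def layerOutput (σ : ℝ → ℝ) {H : ℕ} {m : ℕ → ℕ} (θ : Params H m)
    (x : EuclideanSpace ℝ (Fin (m 0))) : (l : ℕ) → l ≤ H → EuclideanSpace ℝ (Fin (m l))
  | 0, _ => x
  | l + 1, h => WithLp.toLp 2 fun i =>
      (1 / √(m (l + 1) : ℝ)) *
        σ ((∑ j : Fin (m l), θ ⟨⟨l, by omega⟩, i, some j⟩ *
              layerOutput σ θ x l (by omega) j) + θ ⟨⟨l, by omega⟩, i, none⟩)

/-- The network output `f(x, θ) = W^{(H+1)} x^{(H)} + b^{(H+1)}`. -/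
def netOutput (σ : ℝ → ℝ) {H : ℕ} {m : ℕ → ℕ} (x : EuclideanSpace ℝ (Fin (m 0)))
    (θ : Params H m) : EuclideanSpace ℝ (Fin (m (H + 1))) :=
  WithLp.toLp 2 fun i =>
    (∑ j : Fin (m H), θ ⟨⟨H, by omega⟩, i, some j⟩ * layerOutput σ θ x H le_rfl j) +
      θ ⟨⟨H, by omega⟩, i, none⟩

/-- The law of the initial parameter vector `θ⁰`: independent entries, weights `N(0, c_w)` and
biases `N(0, c_b)` (the second argument is the variance). -/
def initLaw (H : ℕ) (m : ℕ → ℕ) (cw cb : NNReal) : Measure (Params H m) :=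
  (Measure.pi fun k : ParamIdx H m => gaussianReal 0 (if k.2.2 = none then cb else cw)).map
    (WithLp.toLp 2)

/-- The one-hot label vector with entry one at the class `k`. -/
def oneHot {K : ℕ} (k : Fin K) : EuclideanSpace ℝ (Fin K) := EuclideanSpace.single k 1

/-- The loss criterion `q ↦ ℓ(q, y)` is nonnegative, differentiable and convex, with `ζ`-Lipschitz
gradient, for every one-hot label `y`. -/
structure IsLossCriterion {K : ℕ}
    (ℓ : EuclideanSpace ℝ (Fin K) → EuclideanSpace ℝ (Fin K) → ℝ) (ζ : ℝ) : Prop where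
  nonneg : ∀ (q : EuclideanSpace ℝ (Fin K)) (k : Fin K), 0 ≤ ℓ q (oneHot k)
  differentiable : ∀ k : Fin K, Differentiable ℝ fun q => ℓ q (oneHot k)
  convex : ∀ k : Fin K, ConvexOn ℝ Set.univ fun q => ℓ q (oneHot k)
  gradLipschitz : ∀ (k : Fin K) (q q' : EuclideanSpace ℝ (Fin K)),
    ‖gradient (fun q => ℓ q (oneHot k)) q - gradient (fun q => ℓ q (oneHot k)) q'‖ ≤ ζ * ‖q - q'‖

/-- The training objective `J(θ) = (1/n) ∑ᵢ ℓ(f(xᵢ, θ), yᵢ)`; a data point is a pair of an input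
and a class, whose label `yᵢ` is the one-hot vector of the class. -/
def trainObjective (σ : ℝ → ℝ) {H : ℕ} {m : ℕ → ℕ}
    (ℓ : EuclideanSpace ℝ (Fin (m (H + 1))) → EuclideanSpace ℝ (Fin (m (H + 1))) → ℝ)
    {n : ℕ} (S : Fin n → EuclideanSpace ℝ (Fin (m 0)) × Fin (m (H + 1))) (θ : Params H m) : ℝ :=
  (1 / (n : ℝ)) * ∑ i, ℓ (netOutput σ (S i).1 θ) (oneHot (S i).2)

/-- The learning-rate vector equal to `α` at the entries of the output layer `[W^{(H+1)}, b^{(H+1)}]`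
and to `0` at all other entries. -/
def lastLayerRate (H : ℕ) (m : ℕ → ℕ) (α : ℝ) : Params H m :=
  WithLp.toLp 2 fun k => if k.1 = Fin.last H then α else 0

/-- Gradient descent `θ^{t+1} = θ^t - η ⊙ ∇J(θ^t)` with the entrywise product `⊙`. -/
def gradDescent {ι : Type} [Fintype ι] (J : EuclideanSpace ℝ ι → ℝ) (η θ₀ : EuclideanSpace ℝ ι) :
    ℕ → EuclideanSpace ℝ ι
  | 0 => θ₀
  | t + 1 => WithLp.toLp 2 fun k =>
      gradDescent J η θ₀ t k - η k * gradient J (gradDescent J η θ₀ t) k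

/-- `‖W̄ᵀ‖_{2,∞}` for `W̄ = [W^{(H+1)}, b^{(H+1)}]`: the largest Euclidean norm of a column of `W̄ᵀ`,
that is, of a row of `W̄`. -/
def lastLayerNorm {H : ℕ} {m : ℕ → ℕ} (θ : Params H m) : ℝ :=
  ⨆ i : Fin (m (H + 1)),
    √(∑ j : Option (Fin (m H)), (θ ⟨⟨H, by omega⟩, i, j⟩) ^ 2)

open Classical in
/-- The 0--1 loss of the output `q` for the class `k`: zero iff `k` is the one maximizer of `q`
(a tie counts as an error). -/
def zeroOneLoss {K : ℕ} (q : EuclideanSpace ℝ (Fin K)) (k : Fin K) : ℝ :=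
  if ∀ j, j ≠ k → q j < q k then 0 else 1

/-- The multiclass margin loss `min(max(1 - (q_k - max_{j ≠ k} q_j)/ρ, 0), 1)`. -/
def marginLoss {K : ℕ} (ρ : ℝ) (q : EuclideanSpace ℝ (Fin K)) (k : Fin K) : ℝ :=
  min (max (1 - (q k - ⨆ j : {j : Fin K // j ≠ k}, q j) / ρ) 0) 1

/-- The property `Q` holds with probability at least `p`. -/
def HoldsWithProb {Ω : Type*} [MeasurableSpace Ω] (μ : Measure Ω) (p : ℝ) (Q : Ω → Prop) : Prop :=
  ∃ E : Set Ω, MeasurableSet E ∧ ENNReal.ofReal p ≤ μ E ∧ ∀ ω ∈ E, Q ω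

end

/-! Gradient descent moves only the output layer, so the hidden layers keep their initial values and
every iterate is a linear predictor on the fixed random features `feature σ θ₀ x`. The proof
therefore follows no training dynamics: it bounds the deviation uniformly over all output matrices
with rows of norm at most `k / ς`, for all integers `k ≥ 1` at once, and then takes `k` to be the
rounded-up scaled norm of the iterate.

For fixed features the bound is a Rademacher argument. The margin loss dominates the 0-1 loss and is
`2/ρ`-Lipschitz in the maximum norm, so `contraction` replaces it by the `m_y` linear outputs, whose
Rademacher average is controlled by row norm times feature norm (`rademacher_linear_le`). Together
with `symmetrization` and `mcdiarmid` this gives `uniform_deviation`, where only the population mean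
of the squared feature norm enters. Row bound `k` receives failure probability `δ' / (π² k²)`, and
these sum to `δ' / 6` (`exists_marginGap_event`).

It remains to bound that mean square with high probability over the initial parameters
(`exists_meanSq_bound`). Given the layer below, pre-activations are independent centred Gaussians,
and since `σ` is bounded on the negative half-line only their squared positive parts matter. These
have mean one half of the variance, and the `p`-norm of their average over a layer of width `m`
exceeds this by at most `e^{8p/m}`. So the squared norms follow an affine recursion with slope `γ
c_w / 2`, below one if `c_w < 2` or `σ` is bounded, which makes the constant independent of the
depth. Up to layer `H - 1`, moments of order about `log (H n² / δ)` give failure probability `δ`,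
and the widths keep the product of the exponential factors bounded.

The width of layer `H` need not exceed a multiple of `log (1/δ)`. That layer is treated
conditionally on the previous ones with moments of order about `n`, which costs an extra probability
`e^{-2n}`. This is harmless: if `δ'` is below `π² e^{-2n}` the square root already exceeds one, and
otherwise `e^{-2n} ≤ δ' / 9`. -/

noncomputable section

/-! ### Rademacher averages -/

namespace MarginBound

open scoped BigOperators

/-- The sign `1` or `-1` attached to a Boolean. -/
def bsign (b : Bool) : ℝ := if b then 1 else -1

lemma bsign_not (b : Bool) : bsign (!b) = -bsign b := by cases b <;> simp [bsign]

lemma bsign_mul_self (b : Bool) : bsign b * bsign b = 1 := by cases b <;> simp [bsign]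

lemma abs_bsign (b : Bool) : |bsign b| = 1 := by cases b <;> simp [bsign]

lemma expect_eq_zero_of_flip {T : Type*} [Fintype T] (e : T ≃ T) (f : T → ℝ)
    (h : ∀ t, f (e t) = -f t) : 𝔼 t, f t = 0 := by
  have h1 : 𝔼 t, -f t = 𝔼 t, f t := Fintype.expect_equiv e _ _ fun t => (h t).symm
  rw [Finset.expect_neg_distrib] at h1
  linarith

/-- Flipping the value at `a`. -/
def flipAt {α : Type*} [DecidableEq α] {β : Type*} (e : β ≃ β) (a : α) : (α → β) ≃ (α → β) :=
  Equiv.piCongrRight fun i => if i = a then e else Equiv.refl β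

lemma flipAt_same {α : Type*} [DecidableEq α] {β : Type*} (e : β ≃ β) (a : α) (f : α → β) :
    flipAt e a f a = e (f a) := by simp [flipAt]

lemma flipAt_ne {α : Type*} [DecidableEq α] {β : Type*} (e : β ≃ β) {a b : α} (h : b ≠ a)
    (f : α → β) : flipAt e a f b = f b := by simp [flipAt, h]

/-- Random signs read off from independent coordinates are orthonormal. -/
lemma expect_sign_mul_sign {α β : Type*} [Fintype α] [DecidableEq α] [Fintype β] [Nonempty β]
    (e : β ≃ β) (s : β → ℝ) (he : ∀ b, s (e b) = -s b) (hs : ∀ b, s b * s b = 1) (a a' : α) :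
    𝔼 f : α → β, s (f a) * s (f a') = if a = a' then 1 else 0 := by
  split_ifs with h
  · subst h
    simp [hs]
  · refine expect_eq_zero_of_flip (flipAt e a) _ fun f => ?_
    rw [flipAt_same, flipAt_ne e (Ne.symm h), he, neg_mul]

lemma expect_bsign {α : Type*} [Fintype α] [DecidableEq α] (a a' : α) :
    𝔼 f : α → Bool, bsign (f a) * bsign (f a') = if a = a' then 1 else 0 :=
  expect_sign_mul_sign Equiv.boolNot bsign bsign_not bsign_mul_self a a'

/-- The lower Khintchine-type bound `max |d_j| ≤ 𝔼 |∑ ε_j d_j|`. -/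
lemma abs_le_expect_abs_sum {K : Type*} [Fintype K] [DecidableEq K] (d : K → ℝ) (j : K) :
    |d j| ≤ 𝔼 e : K → Bool, |∑ k, bsign (e k) * d k| := by
  have h1 : d j = 𝔼 e : K → Bool, bsign (e j) * ∑ k, bsign (e k) * d k := by
    simp_rw [Finset.mul_sum, ← mul_assoc]
    rw [Finset.expect_sum_comm]
    simp_rw [← Finset.expect_mul, expect_bsign]
    simp
  calc |d j| = |𝔼 e : K → Bool, bsign (e j) * ∑ k, bsign (e k) * d k| := by rw [← h1]
    _ ≤ 𝔼 e : K → Bool, |bsign (e j) * ∑ k, bsign (e k) * d k| := Finset.abs_expect_le _ _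
    _ = _ := by simp_rw [abs_mul, abs_bsign, one_mul]

lemma le_ciSup_fin {ι : Type*} [Finite ι] (f : ι → ℝ) (i : ι) : f i ≤ ⨆ j, f j :=
  le_ciSup (Set.finite_range f).bddAbove i

lemma expect_not {K : Type*} [Fintype K] [DecidableEq K] (f : (K → Bool) → ℝ) :
    𝔼 e : K → Bool, f (fun k => !e k) = 𝔼 e, f e :=
  Fintype.expect_equiv (Equiv.piCongrRight fun _ : K => Equiv.boolNot) _ _ fun _ => rfl

/-- One step of the vector contraction inequality. -/
lemma contraction_step {ι K : Type*} [Finite ι] [Nonempty ι] [Fintype K] [DecidableEq K]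
    (A h : ι → ℝ) (g : ι → K → ℝ)
    (hg : ∀ w w', ∃ k, |h w - h w'| ≤ |g w k - g w' k|) :
    𝔼 b : Bool, (⨆ w, (A w + bsign b * h w)) ≤
      𝔼 e : K → Bool, ⨆ w, (A w + ∑ k, bsign (e k) * g w k) := by
  -- With maximizers `w` and `w'` for the two signs, the left side depends on `h` only through `h w
  -- - h w'`, which the hypothesis bounds by a single coordinate of `g`.
  obtain ⟨w, hw⟩ := exists_eq_ciSup_of_finite (f := fun w => A w + bsign true * h w)
  obtain ⟨w', hw'⟩ := exists_eq_ciSup_of_finite (f := fun w => A w + bsign false * h w)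
  set G : (K → Bool) → ℝ := fun e => ⨆ w, (A w + ∑ k, bsign (e k) * g w k) with hG
  have hL : 𝔼 b : Bool, (⨆ w, (A w + bsign b * h w)) = (A w + A w' + (h w - h w')) / 2 := by
    rw [Fintype.expect_eq_sum_div_card]
    simp only [Fintype.univ_bool, Fintype.card_bool]
    rw [Finset.sum_pair (by simp), ← hw, ← hw']
    simp [bsign]; ring
  obtain ⟨k, hk⟩ := hg w w'
  have hk' := hk.trans (abs_le_expect_abs_sum (fun k => g w k - g w' k) k)
  -- Opposite sign vectors are paired: one of `w`, `w'` is tested at `e` and the other at its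
  -- negation, the sign of the sum deciding which.
  have hpt : ∀ e : K → Bool,
      A w + A w' + |∑ k, bsign (e k) * (g w k - g w' k)| ≤ G e + G fun k => !e k := by
    intro e
    have e1 : ∀ v, A v + ∑ k, bsign (e k) * g v k ≤ G e :=
      fun v => le_ciSup_fin (fun w => A w + ∑ k, bsign (e k) * g w k) v
    have e2 : ∀ v, A v - ∑ k, bsign (e k) * g v k ≤ G fun k => !e k := by
      intro v
      have := le_ciSup_fin (fun w => A w + ∑ k, bsign (!e k) * g w k) v
      simp only [bsign_not, neg_mul, Finset.sum_neg_distrib] at this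
      simpa only [hG, bsign_not, neg_mul, Finset.sum_neg_distrib, sub_eq_add_neg] using this
    have e3 : ∑ k, bsign (e k) * (g w k - g w' k) =
        ∑ k, bsign (e k) * g w k - ∑ k, bsign (e k) * g w' k := by
      simp_rw [mul_sub, Finset.sum_sub_distrib]
    rw [e3]
    rcases abs_cases (∑ k, bsign (e k) * g w k - ∑ k, bsign (e k) * g w' k) with ⟨h1, -⟩ | ⟨h1, -⟩
    · rw [h1]; linarith [e1 w, e2 w']
    · rw [h1]; linarith [e1 w', e2 w]
  have hE := Finset.expect_le_expect (s := Finset.univ) fun e _ => hpt e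
  simp only [Finset.expect_add_distrib, Finset.expect_const Finset.univ_nonempty,
    expect_not G] at hE
  rw [hL]
  linarith [le_abs_self (h w - h w')]

lemma expect_fin_succ {β : Type*} [Fintype β] {n : ℕ} (f : (Fin (n + 1) → β) → ℝ) :
    𝔼 e, f e = 𝔼 b : β, 𝔼 e : Fin n → β, f (Fin.cons b e) := by
  have := Finset.expect_product (Finset.univ : Finset β) (Finset.univ : Finset (Fin n → β))
    (fun p => f (Fin.cons p.1 p.2))
  rw [Finset.univ_product_univ] at this
  rw [← this]
  exact (Fintype.expect_equiv (Fin.consEquiv fun _ => β) _ _ fun p => rfl).symm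

/-- **Vector contraction inequality** for random signs. -/
lemma contraction {ι K : Type*} [Finite ι] [Nonempty ι] [Fintype K] [DecidableEq K] {n : ℕ}
    (A : ι → ℝ) (h : Fin n → ι → ℝ) (g : Fin n → ι → K → ℝ)
    (hg : ∀ i w w', ∃ k, |h i w - h i w'| ≤ |g i w k - g i w' k|) :
    𝔼 ε : Fin n → Bool, (⨆ w, (A w + ∑ i, bsign (ε i) * h i w)) ≤
      𝔼 e : Fin n → K → Bool, ⨆ w, (A w + ∑ i, ∑ k, bsign (e i k) * g i w k) := by
  induction n generalizing A with
  | zero => simp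
  | succ n ih =>
    rw [expect_fin_succ, expect_fin_succ]
    -- The signs are exchanged one sample point at a time; the arbitrary offset `A` absorbs the
    -- terms of all other points.
    calc 𝔼 b : Bool, 𝔼 ε : Fin n → Bool,
          (⨆ w, (A w + ∑ i, bsign (Fin.cons (α := fun _ => Bool) b ε i) * h i w))
        ≤ 𝔼 b : Bool, 𝔼 e : Fin n → K → Bool,
          (⨆ w, ((A w + bsign b * h 0 w) + ∑ i, ∑ k, bsign (e i k) * g (Fin.succ i) w k)) := by
          refine Finset.expect_le_expect fun b _ => ?_
          refine le_trans (le_of_eq ?_)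
            (ih (fun w => A w + bsign b * h 0 w) (fun i => h i.succ) (fun i => g i.succ)
              fun i => hg i.succ)
          simp [Fin.sum_univ_succ, add_assoc]
      _ = 𝔼 e : Fin n → K → Bool, 𝔼 b : Bool,
          (⨆ w, ((A w + ∑ i, ∑ k, bsign (e i k) * g (Fin.succ i) w k) + bsign b * h 0 w)) := by
          rw [Finset.expect_comm]
          simp only [add_right_comm]
      _ ≤ 𝔼 e : Fin n → K → Bool, 𝔼 b : K → Bool,
          (⨆ w, ((A w + ∑ i, ∑ k, bsign (e i k) * g (Fin.succ i) w k) +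
            ∑ k, bsign (b k) * g 0 w k)) :=
          Finset.expect_le_expect fun e _ => contraction_step _ _ _ (hg 0)
      _ = _ := by
          rw [Finset.expect_comm]
          simp only [Fin.sum_univ_succ, Fin.cons_zero, Fin.cons_succ]
          simp only [add_assoc, add_comm (∑ i : Fin n, ∑ k, _)]

/-- `𝔼 ‖∑ ε_i v_i‖ ≤ √(∑ ‖v_i‖²)`. -/
lemma expect_norm_sum_le {E : Type*} [NormedAddCommGroup E] [InnerProductSpace ℝ E]
    {α β : Type*} [Fintype α] [DecidableEq α] [Fintype β] [Nonempty β]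
    (e : β ≃ β) (s : β → ℝ) (he : ∀ b, s (e b) = -s b) (hs : ∀ b, s b * s b = 1) (v : α → E) :
    𝔼 f : α → β, ‖∑ a, s (f a) • v a‖ ≤ √(∑ a, ‖v a‖ ^ 2) := by
  -- Independent signs are orthonormal, so the cross terms vanish in the second moment;
  -- Cauchy-Schwarz then bounds the first moment.
  have h2 : 𝔼 f : α → β, ‖∑ a, s (f a) • v a‖ ^ 2 = ∑ a, ‖v a‖ ^ 2 := by
    have : ∀ f : α → β, ‖∑ a, s (f a) • v a‖ ^ 2 =
        ∑ a, ∑ a', (s (f a) * s (f a')) * inner ℝ (v a) (v a') := by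
      intro f
      rw [← real_inner_self_eq_norm_sq, sum_inner]
      refine Finset.sum_congr rfl fun a _ => ?_
      rw [inner_sum]
      refine Finset.sum_congr rfl fun a' _ => ?_
      rw [real_inner_smul_left, real_inner_smul_right]; ring
    simp_rw [this]
    rw [Finset.expect_sum_comm]
    refine Finset.sum_congr rfl fun a _ => ?_
    rw [Finset.expect_sum_comm]
    simp_rw [← Finset.expect_mul, expect_sign_mul_sign e s he hs]
    simp
  refine Real.le_sqrt_of_sq_le ?_
  rw [← h2]
  have := Finset.expect_mul_sq_le_sq_mul_sq (Finset.univ : Finset (α → β))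
    (fun f => ‖∑ a, s (f a) • v a‖) (fun _ => 1)
  simpa [Finset.expect_const Finset.univ_nonempty] using this

/-- The empirical Rademacher complexity of a class of linear multi-output predictors composed with
functions that are Lipschitz in the maximum norm. -/
lemma rademacher_linear_le {ι K E : Type*} [Finite ι] [Nonempty ι] [Fintype K]
    [NormedAddCommGroup E] [InnerProductSpace ℝ E] {n : ℕ}
    (W : ι → K → E) {Λ Lip : ℝ} (hΛ : 0 ≤ Λ) (hLip : 0 ≤ Lip) (hW : ∀ w k, ‖W w k‖ ≤ Λ)
    (v : Fin n → E) (h : Fin n → ι → ℝ)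
    (hh : ∀ i w w', ∃ k, |h i w - h i w'| ≤
      Lip * |inner ℝ (W w k) (v i) - inner ℝ (W w' k) (v i)|) :
    𝔼 ε : Fin n → Bool, (⨆ w, ∑ i, bsign (ε i) * h i w) ≤
      Lip * Λ * Fintype.card K * √(∑ i, ‖v i‖ ^ 2) := by
  classical
  have h1 := contraction (fun _ : ι => (0 : ℝ)) h
    (fun i w k => Lip * inner ℝ (W w k) (v i)) (by
      intro i w w'
      obtain ⟨k, hk⟩ := hh i w w'
      exact ⟨k, by rw [← mul_sub, abs_mul, abs_of_nonneg hLip]; exact hk⟩)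
  simp only [zero_add] at h1
  refine h1.trans ?_
  have h2 : ∀ e : Fin n → K → Bool,
      (⨆ w, ∑ i, ∑ k, bsign (e i k) * (Lip * inner ℝ (W w k) (v i))) ≤
        ∑ k, Lip * Λ * ‖∑ i, bsign (e i k) • v i‖ := by
    intro e
    refine ciSup_le fun w => ?_
    rw [Finset.sum_comm]
    refine Finset.sum_le_sum fun k _ => ?_
    have : ∑ i, bsign (e i k) * (Lip * inner ℝ (W w k) (v i)) =
        Lip * inner ℝ (W w k) (∑ i, bsign (e i k) • v i) := by
      rw [inner_sum, Finset.mul_sum]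
      refine Finset.sum_congr rfl fun i _ => ?_
      rw [real_inner_smul_right]; ring
    rw [this, mul_assoc]
    refine mul_le_mul_of_nonneg_left ?_ hLip
    exact (real_inner_le_norm _ _).trans (mul_le_mul_of_nonneg_right (hW w k) (norm_nonneg _))
  refine (Finset.expect_le_expect fun e _ => h2 e).trans ?_
  rw [Finset.expect_sum_comm]
  have h3 : ∀ k, 𝔼 e : Fin n → K → Bool, Lip * Λ * ‖∑ i, bsign (e i k) • v i‖ ≤
      Lip * Λ * √(∑ i, ‖v i‖ ^ 2) := by
    intro k
    rw [← Finset.mul_expect]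
    refine mul_le_mul_of_nonneg_left ?_ (by positivity)
    -- Each sample point carries a whole vector of signs, of which only coordinate `k` is read; this
    -- is why `expect_norm_sum_le` allows a general `β`.
    exact expect_norm_sum_le (β := K → Bool) (Equiv.piCongrRight fun _ => Equiv.boolNot)
      (fun b => bsign (b k)) (fun b => bsign_not (b k)) (fun b => bsign_mul_self (b k)) v
  refine (Finset.sum_le_sum fun k _ => h3 k).trans (le_of_eq ?_)
  rw [Finset.sum_const, Finset.card_univ, nsmul_eq_mul]; ring

end MarginBound

/-! ### Concentration and uniform deviation -/

namespace MarginBound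

open scoped BigOperators

/-! ### Bounded differences and exponential moments. -/

section Concentration

variable {Z : Type*} [MeasurableSpace Z]

lemma integral_fin_succ (D : Measure Z) [IsProbabilityMeasure D] {n : ℕ}
    (f : (Fin (n + 1) → Z) → ℝ) (hf : Integrable f (Measure.pi fun _ => D)) :
    ∫ S, f S ∂(Measure.pi fun _ => D) =
      ∫ z, ∫ S, f (Fin.cons z S) ∂(Measure.pi fun _ : Fin n => D) ∂D := by
  have hmp := (measurePreserving_piFinSuccAbove (fun _ : Fin (n + 1) => D) 0).symm
  have hcons : ∀ p : Z × (Fin n → Z),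
      (MeasurableEquiv.piFinSuccAbove (fun _ : Fin (n + 1) => Z) 0).symm p
        = Fin.cons p.1 p.2 := fun p => by
    simp [MeasurableEquiv.piFinSuccAbove, Fin.insertNthEquiv]
  have hint : Integrable (fun p : Z × (Fin n → Z) => f (Fin.cons p.1 p.2))
      (D.prod (Measure.pi fun _ => D)) := by
    have := (hmp.integrable_comp_emb (MeasurableEquiv.measurableEmbedding _)).2 hf
    simpa only [Function.comp_def, hcons] using this
  rw [← hmp.integral_comp' f, ← integral_prod _ hint]
  simp only [hcons]

lemma measurable_fin_cons {n : ℕ} :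
    Measurable fun p : Z × (Fin n → Z) => (Fin.cons p.1 p.2 : Fin (n + 1) → Z) := by
  refine measurable_pi_iff.2 fun i => ?_
  refine Fin.cases ?_ (fun j => ?_) i
  · simpa using measurable_fst
  · simpa [Function.comp_def] using (measurable_pi_apply j).comp measurable_snd

lemma integrable_of_abs_le {Ω : Type*} [MeasurableSpace Ω] {μ : Measure Ω} [IsFiniteMeasure μ]
    {f : Ω → ℝ} (hf : Measurable f) {M : ℝ} (hM : ∀ x, |f x| ≤ M) : Integrable f μ :=
  Integrable.of_bound hf.aestronglyMeasurable M (Eventually.of_forall fun x => by simpa using hM x)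

lemma abs_integral_le_of_abs_le {Ω : Type*} [MeasurableSpace Ω] {μ : Measure Ω}
    [IsProbabilityMeasure μ] {f : Ω → ℝ} {M : ℝ} (hM : ∀ x, |f x| ≤ M) : |∫ x, f x ∂μ| ≤ M := by
  simpa using norm_integral_le_of_norm_le_const (μ := μ) (f := f)
    (Eventually.of_forall fun x => (Real.norm_eq_abs (f x)).trans_le (hM x))

/-- Hoeffding's lemma for a function whose oscillation is at most `c`. -/
lemma integral_exp_le_of_osc (D : Measure Z) [IsProbabilityMeasure D] {g : Z → ℝ}
    (hg : Measurable g) {M c : ℝ} (hM : ∀ z, |g z| ≤ M) (hc : ∀ z z', |g z - g z'| ≤ c) (t : ℝ) :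
    ∫ z, Real.exp (t * g z) ∂D ≤ Real.exp (t * ∫ z, g z ∂D + t ^ 2 * c ^ 2 / 8) := by
  have : Nonempty Z := nonempty_of_isProbabilityMeasure D
  have hbdd : BddBelow (Set.range g) := ⟨-M, by rintro _ ⟨z, rfl⟩; exact (abs_le.1 (hM z)).1⟩
  -- An oscillation bound puts the range of `g` in an interval of length `c` starting at its
  -- infimum.
  set a := ⨅ z, g z
  have h1 : ∀ z, g z ∈ Set.Icc a (a + c) := fun z => by
    refine ⟨ciInf_le hbdd z, ?_⟩
    have : g z - c ≤ a := le_ciInf fun z' => by linarith [(abs_le.1 (hc z z')).2]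
    linarith
  have hH := (hasSubgaussianMGF_of_mem_Icc (μ := D) hg.aemeasurable
    (Eventually.of_forall h1)).mgf_le t
  have hc0 : 0 ≤ c := (abs_nonneg _).trans (hc (Classical.arbitrary Z) (Classical.arbitrary Z))
  have hsplit : ∫ z, Real.exp (t * g z) ∂D =
      Real.exp (t * ∫ z, g z ∂D) * mgf (fun z => g z - ∫ z, g z ∂D) D t := by
    rw [mgf, ← integral_const_mul]
    refine integral_congr_ae (Eventually.of_forall fun z => ?_)
    simp only
    rw [← Real.exp_add]; ring_nf
  rw [hsplit, Real.exp_add]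
  refine mul_le_mul_of_nonneg_left (hH.trans (le_of_eq ?_)) (Real.exp_pos _).le
  congr 1
  simp only [add_sub_cancel_left, NNReal.coe_pow, NNReal.coe_div, coe_nnnorm, Real.norm_eq_abs,
    abs_of_nonneg hc0, NNReal.coe_ofNat]
  ring

/-- The moment generating function bound behind **McDiarmid's inequality**. -/
lemma mcdiarmid_mgf (D : Measure Z) [IsProbabilityMeasure D] {n : ℕ} (f : (Fin n → Z) → ℝ)
    (hf : Measurable f) {M c : ℝ} (hM : ∀ S, |f S| ≤ M)
    (hc : ∀ S i z, |f (Function.update S i z) - f S| ≤ c) (t : ℝ) :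
    ∫ S, Real.exp (t * f S) ∂(Measure.pi fun _ => D) ≤
      Real.exp (t * ∫ S, f S ∂(Measure.pi fun _ => D) + n * (t ^ 2 * c ^ 2 / 8)) := by
  induction n with
  | zero =>
    simp only [Nat.cast_zero, zero_mul, add_zero]
    have : ∀ S, f S = f default := fun S => congrArg f (Subsingleton.elim _ _)
    simp only [this, integral_const, probReal_univ, one_smul, le_refl]
  | succ n ih =>
    have hfi : Integrable f (Measure.pi fun _ => D) := integrable_of_abs_le hf hM
    have hexpm : ∀ {Ω : Type _} [MeasurableSpace Ω] {g : Ω → ℝ}, Measurable g →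
        Measurable fun S => Real.exp (t * g S) :=
      fun hg => Real.measurable_exp.comp (hg.const_mul t)
    have hexpb : ∀ x : ℝ, |x| ≤ M → |Real.exp (t * x)| ≤ Real.exp (|t| * M) := fun x hx => by
      rw [abs_of_pos (Real.exp_pos _)]
      refine Real.exp_le_exp.2 ((le_abs_self _).trans ?_)
      rw [abs_mul]; exact mul_le_mul_of_nonneg_left hx (abs_nonneg _)
    have hei : Integrable (fun S => Real.exp (t * f S)) (Measure.pi fun _ : Fin (n + 1) => D) :=
      integrable_of_abs_le (hexpm hf) fun S => hexpb _ (hM S)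
    rw [integral_fin_succ D _ hfi, integral_fin_succ D _ hei]
    -- Averaging over the remaining coordinates keeps the oscillation in the first one below `c`.
    -- Hoeffding's lemma handles `g`, and the induction hypothesis handles each section.
    set g : Z → ℝ := fun z => ∫ S, f (Fin.cons z S) ∂(Measure.pi fun _ : Fin n => D) with hg
    have hsec : ∀ z, Measurable fun S : Fin n → Z => f (Fin.cons z S) := fun z =>
      hf.comp (measurable_fin_cons.comp measurable_prodMk_left)
    have hgm : Measurable g :=
      ((hf.comp measurable_fin_cons).stronglyMeasurable.integral_prod_right').measurable
    have hgM : ∀ z, |g z| ≤ M := fun z => abs_integral_le_of_abs_le fun S => hM _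
    have hgc : ∀ z z', |g z - g z'| ≤ c := fun z z' => by
      rw [hg]
      simp only
      rw [← integral_sub (integrable_of_abs_le (hsec z) fun S => hM _)
        (integrable_of_abs_le (hsec z') fun S => hM _)]
      refine abs_integral_le_of_abs_le fun S => ?_
      have := hc (Fin.cons z' S) 0 z
      rwa [Fin.update_cons_zero] at this
    have hin : ∀ z, ∫ S, Real.exp (t * f (Fin.cons z S)) ∂(Measure.pi fun _ : Fin n => D) ≤
        Real.exp (t * g z) * Real.exp (n * (t ^ 2 * c ^ 2 / 8)) := fun z => by
      rw [← Real.exp_add]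
      refine ih (fun S => f (Fin.cons z S)) (hsec z) (fun S => hM _) fun S i z' => ?_
      have := hc (Fin.cons z S) i.succ z'
      rwa [← Fin.cons_update] at this
    have hosc := integral_exp_le_of_osc D hgm hgM hgc t
    calc ∫ z, ∫ S, Real.exp (t * f (Fin.cons z S)) ∂(Measure.pi fun _ : Fin n => D) ∂D
        ≤ ∫ z, Real.exp (t * g z) * Real.exp (n * (t ^ 2 * c ^ 2 / 8)) ∂D := by
          refine integral_mono_of_nonneg
            (Eventually.of_forall fun z => integral_nonneg fun S => (Real.exp_pos _).le) ?_
            (Eventually.of_forall hin)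
          exact (integrable_of_abs_le (hexpm hgm) fun z => hexpb _ (hgM z)).mul_const _
      _ ≤ Real.exp (t * ∫ z, g z ∂D + t ^ 2 * c ^ 2 / 8) *
            Real.exp (n * (t ^ 2 * c ^ 2 / 8)) := by
          rw [integral_mul_const]
          exact mul_le_mul_of_nonneg_right hosc (Real.exp_pos _).le
      _ = _ := by
          rw [← Real.exp_add]; push_cast; ring_nf

/-- **McDiarmid's inequality** with unit differences. -/
lemma mcdiarmid (D : Measure Z) [IsProbabilityMeasure D] {n : ℕ} (f : (Fin n → Z) → ℝ)
    (hf : Measurable f) {M : ℝ} (hM : ∀ S, |f S| ≤ M)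
    (hc : ∀ S i z, |f (Function.update S i z) - f S| ≤ 1) {ε : ℝ} (hε : 0 ≤ ε) :
    (Measure.pi fun _ => D).real {S | ∫ S, f S ∂(Measure.pi fun _ => D) + n * ε ≤ f S} ≤
      Real.exp (-(2 * n * ε ^ 2)) := by
  have hint : Integrable (fun S => Real.exp (4 * ε * f S)) (Measure.pi fun _ : Fin n => D) := by
    refine integrable_of_abs_le (Real.measurable_exp.comp (hf.const_mul _))
      (M := Real.exp (4 * ε * M)) fun S => ?_
    rw [abs_of_pos (Real.exp_pos _)]
    exact Real.exp_le_exp.2 (mul_le_mul_of_nonneg_left ((le_abs_self _).trans (hM S)) (by positivity))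
  -- The choice `t = 4ε` minimizes the exponent `-t n ε + n t² / 8`.
  have h := measure_ge_le_exp_mul_mgf (μ := Measure.pi fun _ : Fin n => D) (X := f)
    (∫ S, f S ∂(Measure.pi fun _ => D) + n * ε) (t := 4 * ε) (by positivity) hint
  refine h.trans ?_
  refine (mul_le_mul_of_nonneg_left (mcdiarmid_mgf D f hf hM hc (4 * ε)) (Real.exp_pos _).le).trans
    (le_of_eq ?_)
  rw [← Real.exp_add]; ring_nf

end Concentration

/-! ### Ghost samples and uniform deviation over a finite class. -/

section Symmetrization

variable {Z : Type*} [MeasurableSpace Z] {ι : Type*} [Finite ι]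

lemma measurable_ciSup_fin {Ω : Type*} [MeasurableSpace Ω] {f : ι → Ω → ℝ}
    (hf : ∀ i, Measurable (f i)) : Measurable fun x => ⨆ i, f i x :=
  have := Finite.to_countable (α := ι)
  Measurable.iSup hf

variable [Nonempty ι]

lemma abs_ciSup_le_of_abs_le {f : ι → ℝ} {M : ℝ} (h : ∀ i, |f i| ≤ M) : |⨆ i, f i| ≤ M := by
  obtain ⟨i, hi⟩ := exists_eq_ciSup_of_finite (f := f)
  rw [← hi]; exact h i

lemma abs_ciSup_sub_le {f g : ι → ℝ} {c : ℝ} (h : ∀ i, |f i - g i| ≤ c) :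
    |(⨆ i, f i) - ⨆ i, g i| ≤ c := by
  rw [abs_le]
  constructor
  · have : (⨆ i, g i) ≤ (⨆ i, f i) + c :=
      ciSup_le fun i => by linarith [le_ciSup_fin f i, (abs_le.1 (h i)).1]
    linarith
  · have : (⨆ i, f i) ≤ (⨆ i, g i) + c :=
      ciSup_le fun i => by linarith [le_ciSup_fin g i, (abs_le.1 (h i)).2]
    linarith

lemma abs_sum_sign_le {n : ℕ} (ε : Fin n → Bool) {a : Fin n → ℝ} (ha : ∀ i, |a i| ≤ 1) :
    |∑ i, bsign (ε i) * a i| ≤ n := by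
  refine (Finset.abs_sum_le_sum_abs _ _).trans ?_
  calc ∑ i, |bsign (ε i) * a i| ≤ ∑ _i : Fin n, (1 : ℝ) :=
        Finset.sum_le_sum fun i _ => by rw [abs_mul, abs_bsign, one_mul]; exact ha i
    _ = n := by simp

/-- Exchanging the `i`-th points of two independent samples wherever `ε i` is false. -/
lemma measurePreserving_exchange (D : Measure Z) [IsProbabilityMeasure D] {n : ℕ}
    (ε : Fin n → Bool) :
    MeasurePreserving
      (fun p : (Fin n → Z) × (Fin n → Z) =>
        ((fun i => if ε i then p.1 i else p.2 i), (fun i => if ε i then p.2 i else p.1 i)))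
      ((Measure.pi fun _ => D).prod (Measure.pi fun _ => D))
      ((Measure.pi fun _ => D).prod (Measure.pi fun _ => D)) := by
  have he := measurePreserving_arrowProdEquivProdArrow Z Z (Fin n) (fun _ => D) (fun _ => D)
  have hp : MeasurePreserving
      (fun (a : Fin n → Z × Z) i => (if ε i then id else Prod.swap : Z × Z → Z × Z) (a i))
      (Measure.pi fun _ => D.prod D) (Measure.pi fun _ => D.prod D) := by
    refine measurePreserving_pi _ _ (f := fun i => (if ε i then id else Prod.swap)) fun i => ?_
    split_ifs
    · exact MeasurePreserving.id _
    · exact Measure.measurePreserving_swap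
  have hcomp := (he.comp hp).comp he.symm
  convert hcomp using 1
  funext p
  refine Prod.ext (funext fun i => ?_) (funext fun i => ?_)
  · by_cases hi : ε i = true <;>
      simp [hi, MeasurableEquiv.arrowProdEquivProdArrow, Equiv.arrowProdEquivProdArrow]
  · by_cases hi : ε i = true <;>
      simp [hi, MeasurableEquiv.arrowProdEquivProdArrow, Equiv.arrowProdEquivProdArrow]

/-- **Symmetrization**: the expected uniform deviation is at most twice the expected Rademacher
complexity. -/
lemma symmetrization (D : Measure Z) [IsProbabilityMeasure D] {n : ℕ} (h : ι → Z → ℝ)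
    (hm : ∀ w, Measurable (h w)) (h0 : ∀ w z, 0 ≤ h w z) (h1 : ∀ w z, h w z ≤ 1) :
    ∫ S, (⨆ w, ∑ i, (∫ z, h w z ∂D - h w (S i))) ∂(Measure.pi fun _ : Fin n => D) ≤
      2 * ∫ S, 𝔼 ε : Fin n → Bool, (⨆ w, ∑ i, bsign (ε i) * h w (S i))
        ∂(Measure.pi fun _ : Fin n => D) := by
  set μ : Measure (Fin n → Z) := Measure.pi fun _ => D with hμ
  have habs : ∀ w z, |h w z| ≤ 1 := fun w z => abs_le.2 ⟨by linarith [h0 w z], h1 w z⟩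
  have hdiff : ∀ w z z', |h w z - h w z'| ≤ 1 := fun w z z' =>
    abs_le.2 ⟨by linarith [h0 w z, h1 w z'], by linarith [h1 w z, h0 w z']⟩
  have hSm : ∀ w (i : Fin n), Measurable fun S : Fin n → Z => h w (S i) := fun w i =>
    (hm w).comp (measurable_pi_apply i)
  set Ψ : (Fin n → Bool) → (Fin n → Z) × (Fin n → Z) → ℝ := fun ε p =>
    ⨆ w, ∑ i, bsign (ε i) * (h w (p.2 i) - h w (p.1 i)) with hΨ
  have hΨm : ∀ ε, Measurable (Ψ ε) := fun ε => measurable_ciSup_fin fun w =>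
    Finset.measurable_fun_sum _ fun i _ =>
      (((hSm w i).comp measurable_snd).sub ((hSm w i).comp measurable_fst)).const_mul _
  have hΨb : ∀ ε p, |Ψ ε p| ≤ n := fun ε p => abs_ciSup_le_of_abs_le fun w =>
    abs_sum_sign_le ε fun i => hdiff w _ _
  have hΨi : ∀ ε, Integrable (Ψ ε) (μ.prod μ) := fun ε => integrable_of_abs_le (hΨm ε) (hΨb ε)
  set R : (Fin n → Bool) → (Fin n → Z) → ℝ := fun ε S => ⨆ w, ∑ i, bsign (ε i) * h w (S i) with hR
  have hRm : ∀ ε, Measurable (R ε) := fun ε => measurable_ciSup_fin fun w =>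
    Finset.measurable_fun_sum _ fun i _ => (hSm w i).const_mul _
  have hRb : ∀ ε S, |R ε S| ≤ n := fun ε S => abs_ciSup_le_of_abs_le fun w =>
    abs_sum_sign_le ε fun i => habs w _
  have hRi : ∀ ε, Integrable (R ε) μ := fun ε => integrable_of_abs_le (hRm ε) (hRb ε)
  have hexp : ∀ {Ω : Type _} [MeasurableSpace Ω] (ν : Measure Ω) (f : (Fin n → Bool) → Ω → ℝ),
      (∀ ε, Integrable (f ε) ν) → ∫ x, 𝔼 ε, f ε x ∂ν = 𝔼 ε, ∫ x, f ε x ∂ν := by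
    intro Ω _ ν f hf
    simp_rw [Fintype.expect_eq_sum_div_card]
    rw [integral_div, integral_finsetSum _ fun ε _ => hf ε]
  set ε₀ : Fin n → Bool := fun _ => true
  -- The population mean is the average over a ghost sample `S'`, and a supremum of averages is at
  -- most the average of the suprema.
  have step1 : ∀ S, (⨆ w, ∑ i, (∫ z, h w z ∂D - h w (S i))) ≤ ∫ S', Ψ ε₀ (S, S') ∂μ := by
    intro S
    refine ciSup_le fun w => ?_
    have hi : ∀ i : Fin n, Integrable (fun S' : Fin n → Z => h w (S' i)) μ := fun i =>
      integrable_of_abs_le (hSm w i) fun S' => habs w _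
    have : ∑ i, (∫ z, h w z ∂D - h w (S i)) = ∫ S', ∑ i, (h w (S' i) - h w (S i)) ∂μ := by
      rw [integral_finsetSum (f := fun i (S' : Fin n → Z) => h w (S' i) - h w (S i)) _
        fun i _ => (hi i).sub (integrable_const _)]
      refine Finset.sum_congr rfl fun i _ => ?_
      rw [integral_sub (hi i) (integrable_const _), integral_const, probReal_univ, one_smul]
      congr 1
      exact (integral_comp_eval (μ := fun _ : Fin n => D) (i := i)
        (hm w).aestronglyMeasurable).symm
    rw [this]
    refine integral_mono (integrable_finsetSum _ fun i _ => (hi i).sub (integrable_const _))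
      (integrable_of_abs_le ((hΨm ε₀).comp measurable_prodMk_left) fun S' => hΨb _ _) fun S' => ?_
    have := le_ciSup_fin (fun w => ∑ i, bsign (ε₀ i) * (h w (S' i) - h w (S i))) w
    simpa [hΨ, ε₀, bsign] using this
  -- Swapping the points of sample and ghost sample where `ε` is false preserves the product law and
  -- introduces the signs `ε`.
  have step2 : ∀ ε, ∫ p, Ψ ε₀ p ∂(μ.prod μ) = ∫ p, Ψ ε p ∂(μ.prod μ) := by
    intro ε
    have hT := measurePreserving_exchange D ε
    rw [← hμ] at hT
    conv_lhs => rw [← hT.map_eq]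
    rw [integral_map hT.measurable.aemeasurable (hΨm ε₀).aestronglyMeasurable]
    refine integral_congr_ae (Eventually.of_forall fun p => ?_)
    simp only [hΨ]
    congr 1
    funext w
    refine Finset.sum_congr rfl fun i _ => ?_
    by_cases hi : ε i = true <;> simp [hi, ε₀, bsign]
  -- The supremum of a difference splits into two suprema; the one with negated signs has the same
  -- average over sign vectors.
  have step3 : ∀ p : (Fin n → Z) × (Fin n → Z), 𝔼 ε, Ψ ε p ≤ (𝔼 ε, R ε p.2) + 𝔼 ε, R ε p.1 := by
    intro p
    rw [← expect_not fun ε => R ε p.1, ← Finset.expect_add_distrib]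
    refine Finset.expect_le_expect fun ε _ => ?_
    refine ciSup_le fun w => ?_
    have e1 := le_ciSup_fin (fun w => ∑ i, bsign (ε i) * h w (p.2 i)) w
    have e2 := le_ciSup_fin (fun w => ∑ i, bsign (!ε i) * h w (p.1 i)) w
    refine le_trans (le_of_eq ?_) (add_le_add e1 e2)
    simp only [bsign_not]
    rw [← Finset.sum_add_distrib]
    exact Finset.sum_congr rfl fun i _ => by ring
  have hRE : Integrable (fun S => 𝔼 ε, R ε S) μ := by
    simp_rw [Fintype.expect_eq_sum_div_card]
    exact (integrable_finsetSum _ fun ε _ => hRi ε).div_const _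
  have hΨE : Integrable (fun p => 𝔼 ε, Ψ ε p) (μ.prod μ) := by
    simp_rw [Fintype.expect_eq_sum_div_card]
    exact (integrable_finsetSum _ fun ε _ => hΨi ε).div_const _
  have hFm : Measurable fun S : Fin n → Z => ⨆ w, ∑ i, (∫ z, h w z ∂D - h w (S i)) :=
    measurable_ciSup_fin fun w => Finset.measurable_fun_sum _ fun i _ => (hSm w i).const_sub _
  have hFb : ∀ S : Fin n → Z, |⨆ w, ∑ i, (∫ z, h w z ∂D - h w (S i))| ≤ 2 * n := fun S =>
    abs_ciSup_le_of_abs_le fun w => by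
      refine (Finset.abs_sum_le_sum_abs _ _).trans ?_
      calc ∑ i, |∫ z, h w z ∂D - h w (S i)| ≤ ∑ _i : Fin n, (2 : ℝ) :=
            Finset.sum_le_sum fun i _ => by
              have a1 := abs_integral_le_of_abs_le (μ := D) (habs w)
              have a2 := habs w (S i)
              have := abs_sub (∫ z, h w z ∂D) (h w (S i))
              linarith
        _ = 2 * n := by simp [mul_comm]
  calc ∫ S, (⨆ w, ∑ i, (∫ z, h w z ∂D - h w (S i))) ∂μ
      ≤ ∫ S, ∫ S', Ψ ε₀ (S, S') ∂μ ∂μ :=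
        integral_mono (integrable_of_abs_le hFm hFb) (hΨi ε₀).integral_prod_left step1
    _ = ∫ p, Ψ ε₀ p ∂(μ.prod μ) := (integral_prod _ (hΨi ε₀)).symm
    _ = 𝔼 ε, ∫ p, Ψ ε p ∂(μ.prod μ) := by
        rw [← Finset.expect_congr rfl fun ε _ => step2 ε, Finset.expect_const Finset.univ_nonempty]
    _ = ∫ p, 𝔼 ε, Ψ ε p ∂(μ.prod μ) := (hexp _ _ hΨi).symm
    _ ≤ ∫ p, ((𝔼 ε, R ε p.2) + 𝔼 ε, R ε p.1) ∂(μ.prod μ) :=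
        integral_mono hΨE ((hRE.comp_snd μ).add (hRE.comp_fst μ)) step3
    _ = 2 * ∫ S, 𝔼 ε, R ε S ∂μ := by
        rw [integral_add (hRE.comp_snd μ) (hRE.comp_fst μ),
          integral_fun_snd (fun S => 𝔼 ε, R ε S), integral_fun_fst (fun S => 𝔼 ε, R ε S)]
        simp; ring

/-- Jensen's inequality for the square root. -/
lemma integral_sqrt_le {Ω : Type*} [MeasurableSpace Ω] {μ : Measure Ω} [IsProbabilityMeasure μ]
    {f : Ω → ℝ} (h0 : ∀ x, 0 ≤ f x) (hf : Integrable f μ) {a : ℝ} (ha : 0 < a)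
    (hfa : ∫ x, f x ∂μ ≤ a ^ 2) : ∫ x, √(f x) ∂μ ≤ a := by
  -- The arithmetic-geometric mean inequality at the level `a`.
  have hpt : ∀ x, √(f x) ≤ (f x / a + a) / 2 := fun x => by
    have h1 := sq_nonneg (√(f x) - a)
    have h2 := Real.sq_sqrt (h0 x)
    have : f x / a + a = (f x + a ^ 2) / a := by field_simp
    rw [this, le_div_iff₀ two_pos, le_div_iff₀ ha]
    nlinarith
  have hint : Integrable (fun x => (f x / a + a) / 2) μ :=
    ((hf.div_const a).add (integrable_const a)).div_const 2
  calc ∫ x, √(f x) ∂μ ≤ ∫ x, (f x / a + a) / 2 ∂μ :=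
        integral_mono_of_nonneg (Eventually.of_forall fun x => Real.sqrt_nonneg _) hint
          (Eventually.of_forall hpt)
    _ = ((∫ x, f x ∂μ) / a + a) / 2 := by
        rw [integral_div, integral_add (hf.div_const a) (integrable_const a), integral_div]
        simp
    _ ≤ (a ^ 2 / a + a) / 2 := by gcongr
    _ = a := by field_simp; ring

/-- Uniform deviation bound for a finite family of `[0,1]`-valued losses of linear predictors. -/
theorem uniform_deviation {K E : Type*} [Fintype K] [NormedAddCommGroup E] [InnerProductSpace ℝ E]
    (D : Measure Z) [IsProbabilityMeasure D] {n : ℕ} (hn : 1 ≤ n) (h : ι → Z → ℝ)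
    (hm : ∀ w, Measurable (h w)) (h0 : ∀ w z, 0 ≤ h w z) (h1 : ∀ w z, h w z ≤ 1)
    (φ : Z → E) (hφ : Integrable (fun z => ‖φ z‖ ^ 2) D) {B : ℝ} (hB : 0 < B)
    (hφB : ∫ z, ‖φ z‖ ^ 2 ∂D ≤ B ^ 2)
    (W : ι → K → E) {Λ Lip : ℝ} (hΛ : 0 ≤ Λ) (hLip : 0 ≤ Lip) (hW : ∀ w k, ‖W w k‖ ≤ Λ)
    (hh : ∀ z w w', ∃ k, |h w z - h w' z| ≤
      Lip * |inner ℝ (W w k) (φ z) - inner ℝ (W w' k) (φ z)|) {ε : ℝ} (hε : 0 ≤ ε) :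
    (Measure.pi fun _ : Fin n => D).real
        {S | ∃ w, 2 * Lip * Λ * Fintype.card K * B / √n + ε <
          ∫ z, h w z ∂D - (1 / (n : ℝ)) * ∑ i, h w (S i)} ≤ Real.exp (-(2 * n * ε ^ 2)) := by
  set μ : Measure (Fin n → Z) := Measure.pi fun _ => D with hμ
  have hn0 : (0 : ℝ) < n := by exact_mod_cast hn
  have hsn : 0 < √(n : ℝ) := Real.sqrt_pos.2 hn0
  have hdiff : ∀ w z z', |h w z - h w z'| ≤ 1 := fun w z z' =>
    abs_le.2 ⟨by linarith [h0 w z, h1 w z'], by linarith [h1 w z, h0 w z']⟩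
  have habs : ∀ w z, |h w z| ≤ 1 := fun w z => abs_le.2 ⟨by linarith [h0 w z], h1 w z⟩
  have hSm : ∀ w (i : Fin n), Measurable fun S : Fin n → Z => h w (S i) := fun w i =>
    (hm w).comp (measurable_pi_apply i)
  set F : (Fin n → Z) → ℝ := fun S => ⨆ w, ∑ i, (∫ z, h w z ∂D - h w (S i)) with hF
  have hFm : Measurable F :=
    measurable_ciSup_fin fun w => Finset.measurable_fun_sum _ fun i _ => (hSm w i).const_sub _
  have hFb : ∀ S, |F S| ≤ 2 * n := fun S =>
    abs_ciSup_le_of_abs_le fun w => by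
      refine (Finset.abs_sum_le_sum_abs _ _).trans ?_
      calc ∑ i, |∫ z, h w z ∂D - h w (S i)| ≤ ∑ _i : Fin n, (2 : ℝ) :=
            Finset.sum_le_sum fun i _ => by
              have a1 := abs_integral_le_of_abs_le (μ := D) (habs w)
              have a2 := habs w (S i)
              have := abs_sub (∫ z, h w z ∂D) (h w (S i))
              linarith
        _ = 2 * n := by simp [mul_comm]
  -- `F` is a supremum of sums rather than of averages, so changing one sample point alters a single
  -- summand, by at most one.
  have hFc : ∀ S i z, |F (Function.update S i z) - F S| ≤ 1 := fun S i z => by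
    refine abs_ciSup_sub_le fun w => ?_
    rw [← Finset.sum_sub_distrib, Finset.sum_eq_single i]
    · rw [Function.update_self, sub_sub_sub_cancel_left]; exact hdiff _ _ _
    · intro j _ hj; rw [Function.update_of_ne hj, sub_self]
    · simp
  have hmc := mcdiarmid D F hFm hFb hFc hε
  have hsum : Integrable (fun S : Fin n → Z => ∑ i, ‖φ (S i)‖ ^ 2) μ :=
    integrable_finsetSum _ fun i _ => integrable_comp_eval (μ := fun _ : Fin n => D) (i := i) hφ
  have hsumB : ∫ S, ∑ i, ‖φ (S i)‖ ^ 2 ∂μ ≤ (√n * B) ^ 2 := by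
    rw [integral_finsetSum _ fun i _ =>
      integrable_comp_eval (μ := fun _ : Fin n => D) (i := i) hφ]
    have : ∀ i : Fin n, ∫ S, ‖φ (S i)‖ ^ 2 ∂μ = ∫ z, ‖φ z‖ ^ 2 ∂D := fun i =>
      integral_comp_eval (μ := fun _ : Fin n => D) (i := i) (f := fun z => ‖φ z‖ ^ 2)
        hφ.aestronglyMeasurable
    rw [Finset.sum_congr rfl fun i _ => this i, Finset.sum_const, Finset.card_univ, Fintype.card_fin, nsmul_eq_mul, mul_pow,
      Real.sq_sqrt hn0.le]
    exact mul_le_mul_of_nonneg_left hφB hn0.le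
  have hsq := integral_sqrt_le (fun S => Finset.sum_nonneg fun i _ => sq_nonneg _) hsum
    (mul_pos hsn hB) hsumB
  have hEF : ∫ S, F S ∂μ ≤ 2 * (Lip * Λ * Fintype.card K * (√n * B)) := by
    refine (symmetrization D h hm h0 h1).trans (mul_le_mul_of_nonneg_left ?_ zero_le_two)
    have hc : 0 ≤ Lip * Λ * Fintype.card K := by positivity
    have hsqi : Integrable (fun S : Fin n → Z => √(∑ i, ‖φ (S i)‖ ^ 2)) μ := by
      refine Integrable.mono' (hsum.add (integrable_const 1))
        (Real.continuous_sqrt.comp_aestronglyMeasurable hsum.aestronglyMeasurable)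
        (Eventually.of_forall fun S => ?_)
      have hnn : 0 ≤ ∑ i, ‖φ (S i)‖ ^ 2 := Finset.sum_nonneg fun i _ => sq_nonneg _
      rw [Real.norm_of_nonneg (Real.sqrt_nonneg _)]
      simp only [Pi.add_apply]
      rw [Real.sqrt_le_iff]
      constructor <;> nlinarith
    calc ∫ S, 𝔼 ε : Fin n → Bool, (⨆ w, ∑ i, bsign (ε i) * h w (S i)) ∂μ
        ≤ ∫ S, Lip * Λ * Fintype.card K * √(∑ i, ‖φ (S i)‖ ^ 2) ∂μ := by
          refine integral_mono ?_ (hsqi.const_mul _) fun S =>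
            rademacher_linear_le W hΛ hLip hW (fun i => φ (S i)) (fun i w => h w (S i))
              fun i => hh (S i)
          simp_rw [Fintype.expect_eq_sum_div_card]
          refine (integrable_finsetSum _ fun ε _ => ?_).div_const _
          refine integrable_of_abs_le (M := n) ?_ fun S => ?_
          · exact measurable_ciSup_fin fun w =>
              Finset.measurable_fun_sum _ fun i _ => (hSm w i).const_mul _
          · exact abs_ciSup_le_of_abs_le fun w => abs_sum_sign_le ε fun i => habs w _
      _ ≤ _ := by
          rw [integral_const_mul]
          exact mul_le_mul_of_nonneg_left hsq hc
  refine le_trans (measureReal_mono ?_ (measure_ne_top _ _)) hmc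
  rintro S ⟨w, hw⟩
  simp only [Set.mem_ofPred_eq]
  refine le_trans ?_ (le_ciSup_fin (fun w => ∑ i, (∫ z, h w z ∂D - h w (S i))) w)
  rw [Finset.sum_sub_distrib, Finset.sum_const, Finset.card_univ, Fintype.card_fin, nsmul_eq_mul]
  have e1 : (n : ℝ) * (∫ z, h w z ∂D - (1 / (n : ℝ)) * ∑ i, h w (S i)) =
      n * ∫ z, h w z ∂D - ∑ i, h w (S i) := by field_simp
  have e2 : (n : ℝ) * (2 * Lip * Λ * Fintype.card K * B / √n + ε) =
      2 * (Lip * Λ * Fintype.card K * (√n * B)) + n * ε := by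
    have : (n : ℝ) / √n = √n := Real.div_sqrt
    rw [mul_add, mul_div_assoc', mul_comm (n : ℝ), mul_div_assoc, this]; ring
  have := mul_le_mul_of_nonneg_left hw.le hn0.le
  rw [e1, e2] at this
  linarith

end Symmetrization

end MarginBound

/-! ### Moments of Gaussian layers -/

namespace MarginBound

open scoped ENNReal NNReal

section Moments

variable {Ω : Type*} [MeasurableSpace Ω]

/-- Minkowski's inequality against a constant, for integer moments. -/
lemma lintegral_mul_add_const_pow_le {μ : Measure Ω} [IsProbabilityMeasure μ] {f : Ω → ℝ≥0∞}
    (hf : Measurable f) {p : ℕ} (hp : 1 ≤ p) {F : ℝ≥0∞} (hF : ∫⁻ x, f x ^ p ∂μ ≤ F ^ p)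
    (a b : ℝ≥0∞) : ∫⁻ x, (a * f x + b) ^ p ∂μ ≤ (a * F + b) ^ p := by
  have hp0 : (p : ℝ) ≠ 0 := by positivity
  have hp' : p ≠ 0 := by omega
  have key := ENNReal.lintegral_Lp_add_le (μ := μ) (f := fun x => a * f x) (g := fun _ => b)
    (p := (p : ℝ)) (hf.const_mul a).aemeasurable aemeasurable_const (by exact_mod_cast hp)
  simp only [Pi.add_apply, ENNReal.rpow_natCast, lintegral_const, measure_univ, mul_one] at key
  have h1 : (b ^ p) ^ (1 / (p : ℝ)) = b := by
    rw [← ENNReal.rpow_natCast, ← ENNReal.rpow_mul, mul_one_div_cancel hp0, ENNReal.rpow_one]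
  have h2 : (∫⁻ x, (a * f x) ^ p ∂μ) ^ (1 / (p : ℝ)) ≤ a * F := by
    have : ∫⁻ x, (a * f x) ^ p ∂μ ≤ (a * F) ^ p := by
      simp_rw [mul_pow]
      rw [lintegral_const_mul _ (hf.pow_const p)]
      gcongr
    calc _ ≤ ((a * F) ^ p) ^ (1 / (p : ℝ)) := ENNReal.rpow_le_rpow this (by positivity)
      _ = a * F := by
        rw [← ENNReal.rpow_natCast, ← ENNReal.rpow_mul, mul_one_div_cancel hp0, ENNReal.rpow_one]
  have h3 := key.trans (add_le_add h2 h1.le)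
  have h4 := ENNReal.rpow_le_rpow h3 (Nat.cast_nonneg p)
  rwa [← ENNReal.rpow_mul, one_div_mul_cancel hp0, ENNReal.rpow_one, ENNReal.rpow_natCast] at h4

/-- A weighted Minkowski integral inequality for integer moments. -/
lemma lintegral_lintegral_pow_le {X : Type*} [MeasurableSpace X] {μ : Measure Ω} [SFinite μ]
    {D : Measure X} [SFinite D] {f : X → Ω → ℝ≥0∞} (hf : Measurable (Function.uncurry f))
    {s : X → ℝ≥0∞} (hs : Measurable s) (hs0 : ∀ x, s x ≠ 0) (hst : ∀ x, s x ≠ ∞)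
    {p : ℕ} (hp : 1 ≤ p) {R : ℝ≥0∞} (h : ∀ᵐ x ∂D, ∫⁻ a, f x a ^ p ∂μ ≤ s x ^ p * R) :
    ∫⁻ a, (∫⁻ x, f x a ∂D) ^ p ∂μ ≤ (∫⁻ x, s x ∂D) ^ p * R := by
  have hp0 : (p : ℝ) ≠ 0 := by positivity
  have hp1 : (1 : ℝ) ≤ p := by exact_mod_cast hp
  obtain ⟨q, rfl⟩ : ∃ q, p = q + 1 := ⟨p - 1, by omega⟩
  set P : ℝ := ((q + 1 : ℕ) : ℝ) with hP
  have hinv : 1 / P ≤ 1 := by rw [div_le_one (by positivity)]; exact hp1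
  have hq : 1 - 1 / P = q / P := by rw [hP]; push_cast; field_simp; ring
  have hfx : ∀ a, Measurable fun x => f x a := fun a => hf.comp measurable_prodMk_right
  -- Hölder's inequality with exponents `P` and its conjugate. The weights `s` cancel pointwise,
  -- leaving a `p`-th power of `f` whose integral over `a` is controlled by `h`.
  have hH : ∀ a, (∫⁻ x, f x a ∂D) ^ (q + 1) ≤
      (∫⁻ x, f x a ^ (q + 1) * (s x ^ q)⁻¹ ∂D) * (∫⁻ x, s x ∂D) ^ q := by
    intro a
    have hpt : ∀ x, f x a = (f x a ^ (q + 1) * (s x ^ q)⁻¹) ^ (1 / P) * s x ^ (1 - 1 / P) := by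
      intro x
      have e1 : (f x a ^ (q + 1)) ^ (1 / P) = f x a := by
        rw [← ENNReal.rpow_natCast, ← ENNReal.rpow_mul, ← hP, mul_one_div_cancel hp0,
          ENNReal.rpow_one]
      have e2 : (s x)⁻¹ ^ (q / P) * s x ^ (q / P) = 1 := by
        rw [← ENNReal.mul_rpow_of_nonneg _ _ (by positivity),
          ENNReal.inv_mul_cancel (hs0 x) (hst x), ENNReal.one_rpow]
      rw [ENNReal.mul_rpow_of_nonneg _ _ (by positivity), hq, ENNReal.inv_pow, e1,
        ← ENNReal.rpow_natCast (s x)⁻¹ q, ← ENNReal.rpow_mul, mul_one_div, mul_assoc, e2, mul_one]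
    have hh := ENNReal.lintegral_mul_norm_pow_le (μ := D)
      (f := fun x => f x a ^ (q + 1) * (s x ^ q)⁻¹) (g := s)
      (((hfx a).pow_const _).mul (hs.pow_const q).inv).aemeasurable hs.aemeasurable
      (p := 1 / P) (q := 1 - 1 / P) (by positivity) (by linarith) (by ring)
    simp_rw [← hpt] at hh
    have h4 := ENNReal.rpow_le_rpow hh (show 0 ≤ P by positivity)
    rw [ENNReal.mul_rpow_of_nonneg _ _ (by positivity), ← ENNReal.rpow_mul, ← ENNReal.rpow_mul,
      one_div_mul_cancel hp0, ENNReal.rpow_one, hq, div_mul_cancel₀ _ hp0, ENNReal.rpow_natCast,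
      ENNReal.rpow_natCast] at h4
    exact h4
  have hfm : Measurable fun p : Ω × X => f p.2 p.1 := hf.comp measurable_swap
  calc ∫⁻ a, (∫⁻ x, f x a ∂D) ^ (q + 1) ∂μ
      ≤ ∫⁻ a, (∫⁻ x, f x a ^ (q + 1) * (s x ^ q)⁻¹ ∂D) * (∫⁻ x, s x ∂D) ^ q ∂μ :=
        lintegral_mono hH
    _ = (∫⁻ x, ∫⁻ a, f x a ^ (q + 1) * (s x ^ q)⁻¹ ∂μ ∂D) * (∫⁻ x, s x ∂D) ^ q := by
        have hm2 : Measurable fun p : Ω × X => f p.2 p.1 ^ (q + 1) * (s p.2 ^ q)⁻¹ :=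
          (hfm.pow_const _).mul ((hs.comp measurable_snd).pow_const q).inv
        rw [lintegral_mul_const _ hm2.lintegral_prod_right', lintegral_lintegral_swap hm2.aemeasurable]
    _ ≤ (∫⁻ x, s x * R ∂D) * (∫⁻ x, s x ∂D) ^ q := by
        gcongr ?_ * _
        refine lintegral_mono_ae (h.mono fun x hx => ?_)
        rw [lintegral_mul_const _ ((show Measurable (f x) from
          hf.comp measurable_prodMk_left).pow_const _)]
        calc (∫⁻ a, f x a ^ (q + 1) ∂μ) * (s x ^ q)⁻¹ ≤ (s x ^ (q + 1) * R) * (s x ^ q)⁻¹ := by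
              gcongr
          _ = (s x ^ q * (s x ^ q)⁻¹) * (s x * R) := by ring
          _ = s x * R := by
              rw [ENNReal.mul_inv_cancel (pow_ne_zero _ (hs0 x)) (ENNReal.pow_ne_top (hst x)),
                one_mul]
    _ = _ := by rw [lintegral_mul_const _ hs]; ring

/-- Markov's inequality for integer moments. -/
lemma measure_le_of_moment {μ : Measure Ω} {f : Ω → ℝ≥0∞} (hf : Measurable f) {p : ℕ}
    {F r : ℝ≥0∞} (hF0 : F ≠ 0) (hFt : F ≠ ∞) (hr0 : r ≠ 0) (hrt : r ≠ ∞)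
    (hF : ∫⁻ x, f x ^ p ∂μ ≤ F ^ p) :
    μ {x | F * r < f x} ≤ r⁻¹ ^ p := by
  have h1 := mul_meas_ge_le_lintegral (μ := μ) (hf.pow_const p) ((F * r) ^ p)
  have h2 : {x | F * r < f x} ⊆ {x | (F * r) ^ p ≤ f x ^ p} := fun x hx => by
    simp only [Set.mem_ofPred_eq] at hx ⊢
    gcongr
  have hne : (F * r) ^ p ≠ 0 := pow_ne_zero _ (mul_ne_zero hF0 hr0)
  have hnt : (F * r) ^ p ≠ ∞ := ENNReal.pow_ne_top (ENNReal.mul_ne_top hFt hrt)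
  have h3 : (F * r) ^ p * μ {x | F * r < f x} ≤ F ^ p :=
    (mul_le_mul_right (measure_mono h2) _).trans (h1.trans hF)
  have h4 : F ^ p = (F * r) ^ p * r⁻¹ ^ p := by
    rw [← mul_pow, mul_assoc, ENNReal.mul_inv_cancel hr0 hrt, mul_one]
  rw [h4] at h3
  exact (ENNReal.mul_le_mul_iff_right hne hnt).1 h3

end Moments

/-! ### Squared positive parts of Gaussian vectors. -/

section Gaussian

/-- The moment generating function of a squared standard Gaussian variable. -/
lemma lintegral_exp_mul_sq_gaussian {u : ℝ} (hu : u < 1 / 2) :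
    ∫⁻ z, ENNReal.ofReal (Real.exp (u * z ^ 2)) ∂(gaussianReal 0 1) =
      ENNReal.ofReal (1 / √(1 - 2 * u)) := by
  have hb : 0 < 1 / 2 - u := by linarith
  rw [gaussianReal_of_var_ne_zero _ one_ne_zero,
    lintegral_withDensity_eq_lintegral_mul _ (measurable_gaussianPDF 0 1) (by fun_prop)]
  have hpt : ∀ z : ℝ, (gaussianPDF 0 1 * fun z => ENNReal.ofReal (Real.exp (u * z ^ 2))) z =
      ENNReal.ofReal ((√(2 * Real.pi))⁻¹ * Real.exp (-(1 / 2 - u) * z ^ 2)) := by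
    intro z
    rw [Pi.mul_apply, gaussianPDF, ← ENNReal.ofReal_mul (gaussianPDFReal_nonneg _ _ _),
      gaussianPDFReal]
    congr 1
    simp only [NNReal.coe_one, mul_one, sub_zero]
    rw [mul_assoc, ← Real.exp_add]
    congr 2; ring
  simp_rw [hpt]
  rw [← ofReal_integral_eq_lintegral_ofReal ((integrable_exp_neg_mul_sq hb).const_mul _)
    (Eventually.of_forall fun z => by positivity), integral_const_mul, integral_gaussian]
  congr 1
  have hpi := Real.pi_ne_zero
  have h2 : 1 - 2 * u ≠ 0 := by linarith
  rw [← Real.sqrt_inv, ← Real.sqrt_mul (by positivity), one_div (√(1 - 2 * u)), ← Real.sqrt_inv]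
  congr 1
  rw [show 1 / 2 - u = (1 - 2 * u) / 2 by ring]
  field_simp

/-- Adding the values at `z` and `-z` trades squared positive parts for full squares, whose Gaussian
integrals are explicit. -/
lemma lintegral_gaussian_symm {F : ℝ → ℝ≥0∞} (hF : Measurable F) :
    2 * ∫⁻ z, F z ∂(gaussianReal 0 1) = ∫⁻ z, (F z + F (-z)) ∂(gaussianReal 0 1) := by
  have h : ∫⁻ z, F (-z) ∂(gaussianReal 0 1) = ∫⁻ z, F z ∂(gaussianReal 0 1) := by
    have := gaussianReal_map_neg (μ := 0) (v := 1)
    rw [neg_zero] at this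
    conv_rhs => rw [← this]
    rw [lintegral_map hF measurable_neg]
  rw [lintegral_add_left hF, h, two_mul]

/-- After clearing the root and squaring, the claim is `5/4 v² - 5/4 v³ - v⁵ ≥ 0`, which holds for
`v ≤ 1/2`. -/
lemma one_div_sqrt_le {v : ℝ} (hv0 : 0 ≤ v) (hv : v ≤ 1 / 2) :
    1 / √(1 - v) ≤ 1 + v / 2 + v ^ 2 := by
  have h1 : 0 < 1 - v := by linarith
  rw [div_le_iff₀ (Real.sqrt_pos.2 h1)]
  have h2 : (1 : ℝ) ≤ √((1 + v / 2 + v ^ 2) ^ 2 * (1 - v)) := by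
    rw [Real.one_le_sqrt]
    have h3 : v ^ 5 ≤ v ^ 2 * (1 / 8) := by
      have : v ^ 3 ≤ (1 / 2) ^ 3 := by gcongr
      calc v ^ 5 = v ^ 2 * v ^ 3 := by ring
        _ ≤ v ^ 2 * (1 / 8) := by gcongr; linarith
    have h4 : v ^ 3 ≤ v ^ 2 * (1 / 2) := by
      calc v ^ 3 = v ^ 2 * v := by ring
        _ ≤ _ := by gcongr
    nlinarith [sq_nonneg v]
  rwa [Real.sqrt_mul (sq_nonneg _), Real.sqrt_sq (by positivity)] at h2

/-- The moment generating function of the squared positive part of a standard Gaussian. -/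
lemma lintegral_exp_posPart_sq_le {τ : ℝ} (h0 : 0 ≤ τ) (h8 : τ ≤ 1 / 8) :
    ∫⁻ z, ENNReal.ofReal (Real.exp (2 * τ * (max z 0) ^ 2)) ∂(gaussianReal 0 1) ≤
      ENNReal.ofReal (Real.exp (τ + 8 * τ ^ 2)) := by
  have hs := lintegral_gaussian_symm
    (F := fun z => ENNReal.ofReal (Real.exp (2 * τ * (max z 0) ^ 2))) (by fun_prop)
  have hpt : ∀ z : ℝ, ENNReal.ofReal (Real.exp (2 * τ * (max z 0) ^ 2)) +
      ENNReal.ofReal (Real.exp (2 * τ * (max (-z) 0) ^ 2)) =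
      1 + ENNReal.ofReal (Real.exp (2 * τ * z ^ 2)) := by
    intro z
    rcases le_total z 0 with hz | hz
    · simp [max_eq_right hz, max_eq_left (neg_nonneg.2 hz)]
    · simp [max_eq_left hz, max_eq_right (neg_nonpos.2 hz), add_comm]
  simp_rw [hpt] at hs
  rw [lintegral_add_left measurable_const, lintegral_const, measure_univ, mul_one,
    lintegral_exp_mul_sq_gaussian (by linarith)] at hs
  have h1 := one_div_sqrt_le (v := 2 * (2 * τ)) (by positivity) (by linarith)
  have h2 : (1 : ℝ≥0∞) + ENNReal.ofReal (1 / √(1 - 2 * (2 * τ))) ≤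
      2 * ENNReal.ofReal (Real.exp (τ + 8 * τ ^ 2)) := by
    rw [← ENNReal.ofReal_one, ← ENNReal.ofReal_add zero_le_one (by positivity),
      show (2 : ℝ≥0∞) = ENNReal.ofReal 2 by simp, ← ENNReal.ofReal_mul zero_le_two]
    refine ENNReal.ofReal_le_ofReal ?_
    have := Real.add_one_le_exp (τ + 8 * τ ^ 2)
    nlinarith
  rw [← hs] at h2
  exact (ENNReal.mul_le_mul_iff_right two_ne_zero ENNReal.ofNat_ne_top).1 h2

/-- This is the source of the factor one half that makes `c_w = 2` the critical weight variance. -/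
lemma lintegral_posPart_sq : ∫⁻ z, ENNReal.ofReal ((max z 0) ^ 2) ∂(gaussianReal 0 1) =
    ENNReal.ofReal (1 / 2) := by
  have hs := lintegral_gaussian_symm
    (F := fun z => ENNReal.ofReal ((max z 0) ^ 2)) (by fun_prop)
  have hpt : ∀ z : ℝ, ENNReal.ofReal ((max z 0) ^ 2) + ENNReal.ofReal ((max (-z) 0) ^ 2) =
      ENNReal.ofReal (z ^ 2) := by
    intro z
    rcases le_total z 0 with hz | hz
    · simp [max_eq_right hz, max_eq_left (neg_nonneg.2 hz)]
    · simp [max_eq_left hz, max_eq_right (neg_nonpos.2 hz)]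
  simp_rw [hpt] at hs
  have hsq : ∫⁻ z, ENNReal.ofReal (z ^ 2) ∂(gaussianReal 0 1) = 1 := by
    have hm := memLp_id_gaussianReal (μ := 0) (v := 1) 2
    have hv : Var[id; gaussianReal 0 1] = 1 := by simp
    rw [variance_of_integral_eq_zero aemeasurable_id (by simp)] at hv
    simp only [id] at hv
    rw [← ofReal_integral_eq_lintegral_ofReal (f := fun z : ℝ => z ^ 2) hm.integrable_sq
      (Eventually.of_forall fun z => sq_nonneg _)]
    simpa using hv
  rw [hsq] at hs
  have h2 : (2 : ℝ≥0∞) * ENNReal.ofReal (1 / 2) = 1 := by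
    rw [show (2 : ℝ≥0∞) = ENNReal.ofReal 2 by simp, ← ENNReal.ofReal_mul zero_le_two]; simp
  exact (ENNReal.mul_right_inj two_ne_zero ENNReal.ofNat_ne_top).1 (hs.trans h2.symm)

/-- Averages of squared positive parts. -/
def posAvg {m : ℕ} (z : Fin m → ℝ) : ℝ := (1 / (m : ℝ)) * ∑ i, (max (z i) 0) ^ 2

lemma posAvg_nonneg {m : ℕ} (z : Fin m → ℝ) : 0 ≤ posAvg z :=
  mul_nonneg (by positivity) (Finset.sum_nonneg fun _ _ => sq_nonneg _)

lemma measurable_posAvg {m : ℕ} : Measurable (posAvg : (Fin m → ℝ) → ℝ) := by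
  unfold posAvg; fun_prop

lemma posAvg_smul {m : ℕ} {r : ℝ} (hr : 0 ≤ r) (z : Fin m → ℝ) :
    posAvg (fun i => r * z i) = r ^ 2 * posAvg z := by
  unfold posAvg
  have : ∀ i, (max (r * z i) 0) ^ 2 = r ^ 2 * (max (z i) 0) ^ 2 := fun i => by
    rw [← mul_pow, mul_max_of_nonneg _ _ hr, mul_zero]
  simp_rw [this]
  rw [← Finset.mul_sum]; ring

lemma lintegral_pi_prod {m : ℕ} (ν : Measure ℝ) [IsProbabilityMeasure ν] {F : ℝ → ℝ≥0∞}
    (hF : Measurable F) :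
    ∫⁻ z, ∏ i, F (z i) ∂(Measure.pi fun _ : Fin m => ν) = (∫⁻ z, F z ∂ν) ^ m := by
  have hind : iIndepFun (fun (i : Fin m) (z : Fin m → ℝ) => F (z i)) (Measure.pi fun _ => ν) :=
    iIndepFun_pi (X := fun _ => F) fun _ => hF.aemeasurable
  rw [lintegral_prod_eq_prod_lintegral_of_indepFun _ _ hind
    fun i => hF.comp (measurable_pi_apply i)]
  have : ∀ i : Fin m, ∫⁻ z : Fin m → ℝ, F (z i) ∂(Measure.pi fun _ => ν) = ∫⁻ z, F z ∂ν := fun i =>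
    (measurePreserving_eval (fun _ : Fin m => ν) i).lintegral_comp hF
  simp [this]

/-- Moments of the average of squared positive parts of independent standard Gaussians: the
`p`-norm is at most `e^{8p/m} / 2` as long as `p ≤ m / 8` or `p = 1`. -/
lemma lintegral_posAvg_pow_le {m p : ℕ} (hm : 1 ≤ m) (hp : p = 1 ∨ (p : ℝ) ≤ m / 8) :
    ∫⁻ z, ENNReal.ofReal (posAvg z) ^ p ∂(Measure.pi fun _ : Fin m => gaussianReal 0 1) ≤
      ENNReal.ofReal (Real.exp (8 * p / m) / 2) ^ p := by
  have hm0 : (0 : ℝ) < m := by exact_mod_cast hm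
  -- The first moment is exact for every width. It must be allowed separately because a narrow layer
  -- may violate `1 ≤ m / 8`.
  rcases hp with rfl | hp
  · simp only [pow_one]
    have h1 : ∀ z : Fin m → ℝ, ENNReal.ofReal (posAvg z) =
        ENNReal.ofReal (1 / (m : ℝ)) * ∑ i, ENNReal.ofReal ((max (z i) 0) ^ 2) := fun z => by
      rw [posAvg, ENNReal.ofReal_mul (by positivity),
        ENNReal.ofReal_sum_of_nonneg fun i _ => sq_nonneg _]
    simp_rw [h1]
    rw [lintegral_const_mul _ (by fun_prop), lintegral_finsetSum _ (by fun_prop)]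
    have h2 : ∀ i : Fin m, ∫⁻ z : Fin m → ℝ, ENNReal.ofReal ((max (z i) 0) ^ 2)
        ∂(Measure.pi fun _ => gaussianReal 0 1) = ENNReal.ofReal (1 / 2) := fun i =>
      ((measurePreserving_eval (fun _ : Fin m => gaussianReal 0 1) i).lintegral_comp
        (f := fun z => ENNReal.ofReal ((max z 0) ^ 2)) (by fun_prop)).trans lintegral_posPart_sq
    simp_rw [h2]
    rw [Finset.sum_const, Finset.card_univ, Fintype.card_fin, nsmul_eq_mul, ← ENNReal.ofReal_natCast,
      ← ENNReal.ofReal_mul (by positivity), ← ENNReal.ofReal_mul (by positivity)]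
    refine ENNReal.ofReal_le_ofReal ?_
    have : 1 ≤ Real.exp (8 * (1 : ℕ) / m) := Real.one_le_exp (by positivity)
    field_simp at this ⊢
    linarith
  · set τ : ℝ := p / m with hτ
    have hτ0 : 0 ≤ τ := by positivity
    have hτ8 : τ ≤ 1 / 8 := by rw [hτ, div_le_iff₀ hm0]; linarith
    have hpt : ∀ z : Fin m → ℝ, ENNReal.ofReal (posAvg z) ^ p ≤
        ENNReal.ofReal ((Real.exp (-1) / 2) ^ p) *
          ∏ i, ENNReal.ofReal (Real.exp (2 * τ * (max (z i) 0) ^ 2)) := fun z => by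
      rw [← ENNReal.ofReal_prod_of_nonneg fun i _ => (Real.exp_pos _).le, ← Real.exp_sum,
        ← ENNReal.ofReal_mul (by positivity), ← ENNReal.ofReal_pow (posAvg_nonneg z)]
      refine ENNReal.ofReal_le_ofReal ?_
      have e1 : Real.exp (∑ i, 2 * τ * (max (z i) 0) ^ 2) = Real.exp (2 * posAvg z) ^ p := by
        rw [← Real.exp_nat_mul, ← Finset.mul_sum, posAvg, hτ]
        congr 1; field_simp
      rw [e1, ← mul_pow]
      refine pow_le_pow_left₀ (posAvg_nonneg z) ?_ p
      -- The bound `x ≤ e^{2x - 1} / 2` turns the `p`-th power into an exponential of a sum, which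
      -- factorizes over the coordinates. Being tangent at `x = 1/2`, the mean, it is sharp to
      -- leading order.
      have h := Real.add_one_le_exp (-1 + 2 * posAvg z)
      rw [Real.exp_add] at h
      linarith
    refine (lintegral_mono hpt).trans ?_
    rw [lintegral_const_mul _ (by fun_prop), lintegral_pi_prod
      (F := fun x => ENNReal.ofReal (Real.exp (2 * τ * (max x 0) ^ 2))) _ (by fun_prop)]
    refine (mul_le_mul_right (pow_le_pow_left' (lintegral_exp_posPart_sq_le hτ0 hτ8) m) _).trans ?_
    rw [← ENNReal.ofReal_pow (Real.exp_pos _).le, ← ENNReal.ofReal_pow (by positivity),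
      ← ENNReal.ofReal_mul (by positivity)]
    refine ENNReal.ofReal_le_ofReal (le_of_eq ?_)
    -- The exponent is `m (τ + 8τ²) = p + 8p²/m`; its first term cancels the factor `e^{-p}` in
    -- `hpt`.
    have e2 : Real.exp (τ + 8 * τ ^ 2) ^ m = (Real.exp 1 * Real.exp (8 * p / m)) ^ p := by
      rw [← Real.exp_add, ← Real.exp_nat_mul, ← Real.exp_nat_mul, hτ]
      congr 1; field_simp
    rw [e2, ← mul_pow]
    congr 1
    rw [div_mul_eq_mul_div, ← mul_assoc, ← Real.exp_add]
    simp

/-- A linear combination of independent centred Gaussians. -/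
lemma map_linear_pi_gaussian {J : Type*} [Fintype J] (c : J → ℝ≥0) (v : J → ℝ) :
    (Measure.pi fun j => gaussianReal 0 (c j)).map (fun a => ∑ j, a j * v j) =
      gaussianReal 0 (∑ j, (c j : ℝ) * v j ^ 2).toNNReal := by
  have hind : iIndepFun (fun (j : J) (a : J → ℝ) => a j * v j)
      (Measure.pi fun j => gaussianReal 0 (c j)) :=
    iIndepFun_pi (X := fun j x => x * v j) fun j => (measurable_id.mul_const _).aemeasurable
  have hid : ∀ j, HasGaussianLaw (fun x : ℝ => x * v j) (gaussianReal 0 (c j)) := fun j =>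
    ⟨by rw [gaussianReal_map_mul_const]; infer_instance⟩
  have hg : ∀ j, HasGaussianLaw (fun a : J → ℝ => a j * v j)
      (Measure.pi fun j => gaussianReal 0 (c j)) := fun j => by
    refine ⟨?_⟩
    have h1 := (measurePreserving_eval (fun j => gaussianReal 0 (c j)) j).map_eq
    have h2 : (fun a : J → ℝ => a j * v j) = (fun x => x * v j) ∘ Function.eval j := rfl
    rw [h2, ← Measure.map_map (by fun_prop) (by fun_prop), h1, gaussianReal_map_mul_const]
    infer_instance
  have hsum := hind.hasGaussianLaw_fun_sum hg
  rw [hsum.map_eq_gaussianReal]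
  have hmean : ∫ a, ∑ j, a j * v j ∂(Measure.pi fun j => gaussianReal 0 (c j)) = 0 := by
    rw [integral_finsetSum _ fun j _ => (hg j).integrable]
    refine Finset.sum_eq_zero fun j _ => ?_
    rw [integral_comp_eval (μ := fun j => gaussianReal 0 (c j)) (i := j) (f := fun x => x * v j)
      (by fun_prop), integral_mul_const]
    simp
  have hvar : Var[fun a => ∑ j, a j * v j; Measure.pi fun j => gaussianReal 0 (c j)] =
      ∑ j, (c j : ℝ) * v j ^ 2 := by
    have h := variance_sum_pi (μ := fun j => gaussianReal 0 (c j)) (X := fun j x => x * v j)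
      fun j => (hid j).memLp_two
    have h2 : (∑ j, fun a : J → ℝ => a j * v j) = fun a => ∑ j, a j * v j := by
      ext a; simp
    rw [h2] at h
    rw [h]
    refine Finset.sum_congr rfl fun j _ => ?_
    rw [variance_mul_const, variance_fun_id_gaussianReal, mul_comm]
  rw [hmean, hvar]

/-- The joint law of the outputs of a random linear layer. -/
lemma map_layer_pi_gaussian {I J : Type*} [Fintype I] [Fintype J] (c : J → ℝ≥0) (v : J → ℝ) :
    (Measure.pi fun p : I × J => gaussianReal 0 (c p.2)).map
        (fun a i => ∑ j, a (i, j) * v j) =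
      Measure.pi fun _ : I => gaussianReal 0 (∑ j, (c j : ℝ) * v j ^ 2).toNNReal := by
  have hcurry := Measure.infinitePi_map_curry (fun (_ : I) (j : J) => gaussianReal 0 (c j))
  simp only [Measure.infinitePi_eq_pi] at hcurry
  have h1 : (fun (a : I × J → ℝ) i => ∑ j, a (i, j) * v j) =
      (fun (b : I → J → ℝ) i => ∑ j, b i j * v j) ∘ MeasurableEquiv.curry I J ℝ := rfl
  rw [h1, ← Measure.map_map (by fun_prop) (by fun_prop), hcurry,
    Measure.pi_map_pi (μ := fun _ : I => Measure.pi fun j => gaussianReal 0 (c j))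
      (f := fun _ (b : J → ℝ) => ∑ j, b j * v j)
      (fun i => (show Measurable fun b : J → ℝ => ∑ j, b j * v j by fun_prop).aemeasurable)]
  simp_rw [map_linear_pi_gaussian]

/-- Integrals against independent centred Gaussians reduce to standard ones. -/
lemma lintegral_pi_gaussian_scale {m : ℕ} {s : ℝ} (hs : 0 ≤ s) {F : (Fin m → ℝ) → ℝ≥0∞}
    (hF : Measurable F) :
    ∫⁻ g, F g ∂(Measure.pi fun _ : Fin m => gaussianReal 0 s.toNNReal) =
      ∫⁻ z, F (fun i => √s * z i) ∂(Measure.pi fun _ : Fin m => gaussianReal 0 1) := by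
  have h1 : (gaussianReal 0 1).map (√s * ·) = gaussianReal 0 s.toNNReal := by
    rw [gaussianReal_map_const_mul, mul_zero, mul_one]
    congr 1
    ext
    simp [Real.sq_sqrt hs, hs]
  have h2 : (Measure.pi fun _ : Fin m => gaussianReal 0 1).map (fun z i => √s * z i) =
      Measure.pi fun _ : Fin m => gaussianReal 0 s.toNNReal := by
    have := Measure.pi_map_pi (μ := fun _ : Fin m => gaussianReal 0 1) (f := fun _ x => √s * x)
      fun i => by fun_prop
    rw [this]
    simp_rw [h1]
  rw [← h2, lintegral_map hF (by fun_prop)]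

end Gaussian

end MarginBound

/-! ### The law of the initial parameters, layer by layer -/

namespace MarginBound

open scoped ENNReal NNReal

variable {H : ℕ} {m : ℕ → ℕ}

/-- The parameters of one layer. -/
abbrev LayerParams (m : ℕ → ℕ) (l : ℕ) : Type := Fin (m (l + 1)) × Option (Fin (m l)) → ℝ

/-- The initial law of the parameters of one layer. -/
def layerLaw (m : ℕ → ℕ) (cw cb : ℝ≥0) (l : ℕ) : Measure (LayerParams m l) :=
  Measure.pi fun p => gaussianReal 0 (if p.2 = none then cb else cw)

instance (m : ℕ → ℕ) (cw cb : ℝ≥0) (l : ℕ) : IsProbabilityMeasure (layerLaw m cw cb l) := by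
  unfold layerLaw; infer_instance

instance (H : ℕ) (m : ℕ → ℕ) (cw cb : ℝ≥0) : IsProbabilityMeasure (initLaw H m cw cb) := by
  unfold initLaw
  exact Measure.isProbabilityMeasure_map (by fun_prop)

/-- The parameter vector with parameters `a` in layer `l` and `b` in the other layers. -/
def assemble (l : Fin (H + 1)) (a : LayerParams m l)
    (b : ∀ j : Fin H, LayerParams m (l.succAbove j)) : Params H m :=
  WithLp.toLp 2 fun k => (Fin.insertNth (α := fun i : Fin (H + 1) => LayerParams m i) l a b) k.1 k.2

lemma assemble_same (l : Fin (H + 1)) (a : LayerParams m l)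
    (b : ∀ j : Fin H, LayerParams m (l.succAbove j)) (p) : assemble l a b ⟨l, p⟩ = a p := by
  simp [assemble]

lemma assemble_ne (l : Fin (H + 1)) (a a' : LayerParams m l)
    (b : ∀ j : Fin H, LayerParams m (l.succAbove j)) (k : ParamIdx H m) (hk : k.1 ≠ l) :
    assemble l a b k = assemble l a' b k := by
  obtain ⟨i, p⟩ := k
  obtain ⟨j, rfl⟩ := Fin.exists_succAbove_eq hk
  simp [assemble]

lemma measurable_assemble (l : Fin (H + 1)) :
    Measurable fun q : LayerParams m l × (∀ j : Fin H, LayerParams m (l.succAbove j)) =>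
      assemble l q.1 q.2 := by
  have h := (MeasurableEquiv.piFinSuccAbove (fun i : Fin (H + 1) => LayerParams m i) l).symm.measurable
  have h2 : Measurable fun q : LayerParams m l × (∀ j : Fin H, LayerParams m (l.succAbove j)) =>
      fun k : ParamIdx H m => (Fin.insertNth (α := fun i : Fin (H + 1) => LayerParams m i) l
        q.1 q.2) k.1 k.2 := by
    refine measurable_pi_iff.2 fun k => ?_
    exact (measurable_pi_apply k.2).comp ((measurable_pi_apply k.1).comp h)
  exact (WithLp.measurable_toLp 2 _).comp h2

/-- Integrating out one layer of the initial parameters. -/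
lemma lintegral_initLaw (cw cb : ℝ≥0) (l : Fin (H + 1)) {F : Params H m → ℝ≥0∞}
    (hF : Measurable F) :
    ∫⁻ θ, F θ ∂(initLaw H m cw cb) =
      ∫⁻ b, ∫⁻ a, F (assemble l a b) ∂(layerLaw m cw cb l)
        ∂(Measure.pi fun j : Fin H => layerLaw m cw cb (l.succAbove j)) := by
  have hc := Measure.infinitePi_map_piCurry_symm (ι := Fin (H + 1))
    (κ := fun i => Fin (m (i + 1)) × Option (Fin (m i))) (X := fun _ _ => ℝ)
    (fun _ p => gaussianReal 0 (if p.2 = none then cb else cw))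
  simp only [Measure.infinitePi_eq_pi] at hc
  have hs := (measurePreserving_piFinSuccAbove
    (fun i : Fin (H + 1) => layerLaw m cw cb i) l).symm
  rw [initLaw, lintegral_map hF (by fun_prop), ← hc]
  have hF2 : Measurable fun a : ParamIdx H m → ℝ => F (WithLp.toLp 2 a) := by fun_prop
  rw [lintegral_map hF2 (MeasurableEquiv.measurable _)]
  have hF3 := hF2.comp (MeasurableEquiv.piCurry
    (fun (i : Fin (H + 1)) (_ : Fin (m (i + 1)) × Option (Fin (m i))) => ℝ)).symm.measurable
  have e1 := hs.lintegral_comp hF3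
  exact e1.symm.trans (lintegral_prod_symm _ (hF3.comp hs.measurable).aemeasurable)

variable {σ : ℝ → ℝ}

/-- Parameter index `l` holds the weights into layer `l + 1`, so the output of layer `l` sees only
indices strictly below `l`. Both the conditioning on earlier layers and the invariance under
training rest on this. -/
lemma layerOutput_congr {θ θ' : Params H m} (x : EuclideanSpace ℝ (Fin (m 0))) (l : ℕ)
    (h : l ≤ H) (hθ : ∀ k : ParamIdx H m, k.1.val < l → θ k = θ' k) :
    layerOutput σ θ x l h = layerOutput σ θ' x l h := by
  induction l with
  | zero => rfl
  | succ l ih =>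
    have ih' := ih (by omega) fun k hk => hθ k (by omega)
    simp only [layerOutput]
    congr 1
    funext i
    rw [ih', hθ ⟨⟨l, by omega⟩, i, none⟩ (by simp)]
    congr 3
    refine Finset.sum_congr rfl fun j _ => ?_
    rw [hθ ⟨⟨l, by omega⟩, i, some j⟩ (by simp)]

lemma continuous_layerOutput (hσ : Continuous σ) (l : ℕ) (h : l ≤ H) :
    Continuous fun p : Params H m × EuclideanSpace ℝ (Fin (m 0)) => layerOutput σ p.1 p.2 l h := by
  induction l with
  | zero => exact continuous_snd
  | succ l ih =>
    have ih' := ih (by omega)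
    simp only [layerOutput]
    refine (PiLp.continuous_toLp 2 _).comp (continuous_pi fun i => continuous_const.mul
      (hσ.comp (Continuous.add (continuous_finsetSum _ fun j _ => Continuous.mul ?_ ?_) ?_)))
    · exact (EuclideanSpace.proj _).continuous.comp continuous_fst
    · exact (EuclideanSpace.proj j).continuous.comp ih'
    · exact (EuclideanSpace.proj _).continuous.comp continuous_fst

/-- Input weights of the next layer with the constant input one of the bias. -/
def augment {k : ℕ} (v : EuclideanSpace ℝ (Fin k)) : Option (Fin k) → ℝ
  | none => 1
  | some j => v j

/-- The inputs of the activation functions of layer `l + 1`. -/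
def preAct {l : ℕ} (a : LayerParams m l) (v : EuclideanSpace ℝ (Fin (m l))) :
    Fin (m (l + 1)) → ℝ :=
  fun i => ∑ j, a (i, j) * augment v j

lemma measurable_preAct {l : ℕ} : Measurable fun q : LayerParams m l × EuclideanSpace ℝ (Fin (m l)) =>
    preAct q.1 q.2 := by
  refine measurable_pi_iff.2 fun i => ?_
  unfold preAct
  simp only [Fintype.sum_option, augment]
  fun_prop

/-- The reference value `a₀` is arbitrary, because the previous layer does not see these parameters;
with `a₀` fixed, `a` can be integrated out at a constant input. -/
lemma layerOutput_succ_assemble (l : ℕ) (hl : l < H) (a a₀ : LayerParams m l)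
    (b : ∀ j : Fin H, LayerParams m ((⟨l, by omega⟩ : Fin (H + 1)).succAbove j))
    (x : EuclideanSpace ℝ (Fin (m 0))) (i : Fin (m (l + 1))) :
    layerOutput σ (assemble ⟨l, by omega⟩ a b) x (l + 1) hl i =
      (1 / √(m (l + 1) : ℝ)) *
        σ (preAct a (layerOutput σ (assemble ⟨l, by omega⟩ a₀ b) x l (by omega)) i) := by
  rw [layerOutput_congr (θ := assemble ⟨l, by omega⟩ a₀ b) (θ' := assemble ⟨l, by omega⟩ a b) x l
    (by omega) fun k hk => assemble_ne _ _ _ _ _ fun h => by rw [h] at hk; simp at hk]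
  simp only [layerOutput, preAct, Fintype.sum_option, augment]
  congr 2
  rw [add_comm]
  congr 1
  · rw [mul_one]; exact assemble_same _ _ _ _
  · refine Finset.sum_congr rfl fun j _ => ?_
    congr 1
    exact assemble_same _ _ _ _

/-- The scaling by `1/√m` makes the squared norm an average of squared activations, hence at most an
affine function of `posAvg`. -/
lemma norm_sq_layerOutput_succ_le {γ B : ℝ} (hσB : ∀ u, σ u ^ 2 ≤ γ * (max u 0) ^ 2 + B)
    (l : ℕ) (hl : l < H) (hm : 1 ≤ m (l + 1)) (a a₀ : LayerParams m l)
    (b : ∀ j : Fin H, LayerParams m ((⟨l, by omega⟩ : Fin (H + 1)).succAbove j))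
    (x : EuclideanSpace ℝ (Fin (m 0))) :
    ‖layerOutput σ (assemble ⟨l, by omega⟩ a b) x (l + 1) hl‖ ^ 2 ≤
      γ * posAvg (preAct a (layerOutput σ (assemble ⟨l, by omega⟩ a₀ b) x l (by omega))) + B := by
  have hm0 : (0 : ℝ) < m (l + 1) := by exact_mod_cast hm
  rw [EuclideanSpace.real_norm_sq_eq]
  simp_rw [layerOutput_succ_assemble l hl a a₀ b x]
  set g := preAct a (layerOutput σ (assemble ⟨l, by omega⟩ a₀ b) x l (by omega))
  calc ∑ i, (1 / √(m (l + 1) : ℝ) * σ (g i)) ^ 2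
      ≤ ∑ i, (1 / (m (l + 1) : ℝ)) * (γ * (max (g i) 0) ^ 2 + B) := by
        refine Finset.sum_le_sum fun i _ => ?_
        rw [mul_pow, div_pow, one_pow, Real.sq_sqrt hm0.le]
        exact mul_le_mul_of_nonneg_left (hσB _) (by positivity)
    _ = _ := by
        rw [← Finset.mul_sum, Finset.sum_add_distrib, ← Finset.mul_sum, posAvg, Finset.sum_const,
          Finset.card_univ, Fintype.card_fin, nsmul_eq_mul]
        field_simp

/-- The common factor in the `p`-th moment bound for a layer of width `k`. -/
def momentFactor (p k : ℕ) : ℝ := Real.exp (8 * p / k) / 2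

lemma momentFactor_pos (p k : ℕ) : 0 < momentFactor p k := by unfold momentFactor; positivity

/-- For a fixed input the pre-activations are independent centred Gaussians of variance `cw ‖v‖² +
cb`, and `posAvg` is homogeneous of degree two. -/
lemma lintegral_posAvg_preAct_pow_le (cw cb : ℝ≥0) {l p : ℕ} (hm : 1 ≤ m (l + 1))
    (hp : p = 1 ∨ (p : ℝ) ≤ m (l + 1) / 8) (v : EuclideanSpace ℝ (Fin (m l))) :
    ∫⁻ a, ENNReal.ofReal (posAvg (preAct a v)) ^ p ∂(layerLaw m cw cb l) ≤
      (ENNReal.ofReal (cw * ‖v‖ ^ 2 + cb) * ENNReal.ofReal (momentFactor p (m (l + 1)))) ^ p := by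
  have hlaw := map_layer_pi_gaussian (I := Fin (m (l + 1)))
    (fun j : Option (Fin (m l)) => if j = none then cb else cw) (augment v)
  have hs : ∑ j, ((if j = none then cb else cw : ℝ≥0) : ℝ) * augment v j ^ 2 =
      cw * ‖v‖ ^ 2 + cb := by
    rw [Fintype.sum_option, EuclideanSpace.real_norm_sq_eq, Finset.mul_sum]
    simp [augment, add_comm]
  rw [hs] at hlaw
  have hs0 : (0 : ℝ) ≤ cw * ‖v‖ ^ 2 + cb := by positivity
  have hmeas : Measurable fun g : Fin (m (l + 1)) → ℝ => ENNReal.ofReal (posAvg g) ^ p :=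
    measurable_posAvg.ennreal_ofReal.pow_const p
  have hg : Measurable fun (a : LayerParams m l) i => ∑ j, a (i, j) * augment v j := by fun_prop
  have e1 : ∫⁻ a, ENNReal.ofReal (posAvg (preAct a v)) ^ p ∂(layerLaw m cw cb l) =
      ∫⁻ g, ENNReal.ofReal (posAvg g) ^ p
        ∂(Measure.pi fun _ : Fin (m (l + 1)) => gaussianReal 0 (cw * ‖v‖ ^ 2 + cb).toNNReal) := by
    rw [← hlaw, lintegral_map hmeas hg]
    rfl
  rw [e1, lintegral_pi_gaussian_scale hs0 hmeas]
  simp_rw [posAvg_smul (Real.sqrt_nonneg _), Real.sq_sqrt hs0, ENNReal.ofReal_mul hs0, mul_pow]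
  rw [lintegral_const_mul _ hmeas]
  gcongr
  exact lintegral_posAvg_pow_le hm hp

lemma measurable_norm_sq_layerOutput (hσ : Continuous σ) (l : ℕ) (h : l ≤ H) :
    Measurable fun p : Params H m × EuclideanSpace ℝ (Fin (m 0)) =>
      ‖layerOutput σ p.1 p.2 l h‖ ^ 2 :=
  ((continuous_layerOutput hσ l h).norm.pow 2).measurable

/-- Moments of the squared norm of a hidden layer propagate to the next one. -/
lemma moment_succ (hσ : Continuous σ) {γ B : ℝ} (hγ : 0 ≤ γ) (hB : 0 ≤ B)
    (hσB : ∀ u, σ u ^ 2 ≤ γ * (max u 0) ^ 2 + B) (cw cb : ℝ≥0) {l p : ℕ} (hl : l < H)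
    (hm : 1 ≤ m (l + 1)) (hp1 : 1 ≤ p) (hp : p = 1 ∨ (p : ℝ) ≤ m (l + 1) / 8)
    (x : EuclideanSpace ℝ (Fin (m 0))) {M : ℝ} (hM : 0 ≤ M)
    (h : ∫⁻ θ, ENNReal.ofReal (‖layerOutput σ θ x l hl.le‖ ^ 2) ^ p ∂(initLaw H m cw cb) ≤
      ENNReal.ofReal M ^ p) :
    ∫⁻ θ, ENNReal.ofReal (‖layerOutput σ θ x (l + 1) hl‖ ^ 2) ^ p ∂(initLaw H m cw cb) ≤
      ENNReal.ofReal (γ * momentFactor p (m (l + 1)) * (cw * M + cb) + B) ^ p := by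
  set L : Fin (H + 1) := ⟨l, by omega⟩ with hL
  have hX := momentFactor_pos p (m (l + 1))
  set X := momentFactor p (m (l + 1))
  have hmeas : ∀ k (hk : k ≤ H), Measurable fun θ : Params H m =>
      ENNReal.ofReal (‖layerOutput σ θ x k hk‖ ^ 2) := fun k hk =>
    ((measurable_norm_sq_layerOutput hσ k hk).comp measurable_prodMk_right).ennreal_ofReal
  rw [lintegral_initLaw cw cb L ((hmeas _ _).pow_const p)] at h ⊢
  set Q : (∀ j : Fin H, LayerParams m (L.succAbove j)) → ℝ := fun b =>
    ‖layerOutput σ (assemble L 0 b) x l hl.le‖ ^ 2 with hQ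
  have hcong : ∀ a b, layerOutput σ (assemble L a b) x l hl.le =
      layerOutput σ (assemble L 0 b) x l hl.le := fun a b =>
    layerOutput_congr x l hl.le fun k hk => assemble_ne _ _ _ _ _ fun h => by
      rw [h] at hk; simp [hL] at hk
  have hQm : Measurable fun b => ENNReal.ofReal (Q b) :=
    (hmeas l hl.le).comp ((measurable_assemble L).comp measurable_prodMk_left)
  have hQM : ∫⁻ b, ENNReal.ofReal (Q b) ^ p
      ∂(Measure.pi fun j : Fin H => layerLaw m cw cb (L.succAbove j)) ≤ ENNReal.ofReal M ^ p := by
    refine le_trans (le_of_eq ?_) h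
    simp_rw [hcong]
    simp [hQ]
  have hin : ∀ b, ∫⁻ a, ENNReal.ofReal (‖layerOutput σ (assemble L a b) x (l + 1) hl‖ ^ 2) ^ p
      ∂(layerLaw m cw cb L) ≤
      (ENNReal.ofReal (γ * X * cw) * ENNReal.ofReal (Q b) + ENNReal.ofReal (γ * X * cb + B)) ^ p := by
    intro b
    set v := layerOutput σ (assemble L 0 b) x l hl.le
    have hpm : Measurable fun a : LayerParams m l => ENNReal.ofReal (posAvg (preAct a v)) :=
      (measurable_posAvg.comp (measurable_preAct.comp measurable_prodMk_right)).ennreal_ofReal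
    calc _ ≤ ∫⁻ a, (ENNReal.ofReal γ * ENNReal.ofReal (posAvg (preAct a v)) + ENNReal.ofReal B) ^ p
          ∂(layerLaw m cw cb l) := by
          refine lintegral_mono fun a => pow_le_pow_left' ?_ p
          rw [← ENNReal.ofReal_mul hγ,
            ← ENNReal.ofReal_add (mul_nonneg hγ (posAvg_nonneg _)) hB]
          exact ENNReal.ofReal_le_ofReal (norm_sq_layerOutput_succ_le hσB l hl hm a 0 b x)
      _ ≤ (ENNReal.ofReal γ * (ENNReal.ofReal (cw * ‖v‖ ^ 2 + cb) * ENNReal.ofReal X) +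
            ENNReal.ofReal B) ^ p :=
          lintegral_mul_add_const_pow_le hpm hp1 (lintegral_posAvg_preAct_pow_le cw cb hm hp v) _ _
      _ = _ := by
          rw [← ENNReal.ofReal_mul (by positivity), ← ENNReal.ofReal_mul (by positivity),
            ← ENNReal.ofReal_mul (by positivity), ← ENNReal.ofReal_add (by positivity) hB,
            ← ENNReal.ofReal_add (by positivity) (by positivity)]
          congr 2
          simp only [hQ]; ring
  refine (lintegral_mono hin).trans ?_
  refine (lintegral_mul_add_const_pow_le hQm hp1 hQM _ _).trans (le_of_eq ?_)
  rw [← ENNReal.ofReal_mul (by positivity), ← ENNReal.ofReal_add (by positivity) (by positivity)]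
  congr 2
  ring

/-- The recursion `a₀ = 1`, `a_{l+1} = r a_l + β` that governs the norms of the hidden layers. -/
def affineIter (r β : ℝ) : ℕ → ℝ
  | 0 => 1
  | l + 1 => r * affineIter r β l + β

lemma affineIter_nonneg {r β : ℝ} (hr : 0 ≤ r) (hβ : 0 ≤ β) (l : ℕ) : 0 ≤ affineIter r β l := by
  induction l with
  | zero => exact zero_le_one
  | succ l ih => simp only [affineIter]; positivity

/-- For `r < 1` the iteration contracts towards its fixed point `β / (1 - r)`. -/
lemma affineIter_le {r β : ℝ} (hr : 0 ≤ r) (hβ : 0 ≤ β) (hr1 : r < 1) (l : ℕ) :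
    affineIter r β l ≤ 1 + β / (1 - r) := by
  have h1 : 0 < 1 - r := by linarith
  induction l with
  | zero => simp only [affineIter]; linarith [div_nonneg hβ h1.le]
  | succ l ih =>
    simp only [affineIter]
    have h2 := mul_le_mul_of_nonneg_left ih hr
    have h3 : β / (1 - r) * (1 - r) = β := div_mul_cancel₀ _ h1.ne'
    nlinarith

/-- Moments of the squared norms of the hidden layers. -/
lemma moment_le (hσ : Continuous σ) {γ B : ℝ} (hγ : 0 ≤ γ) (hB : 0 ≤ B)
    (hσB : ∀ u, σ u ^ 2 ≤ γ * (max u 0) ^ 2 + B) (cw cb : ℝ≥0) {p : ℕ} (hp1 : 1 ≤ p)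
    (x : EuclideanSpace ℝ (Fin (m 0))) (hx : ‖x‖ = 1) (l : ℕ) (hl : l ≤ H)
    (hm : ∀ k < l, 1 ≤ m (k + 1)) (hp : ∀ k < l, p = 1 ∨ (p : ℝ) ≤ m (k + 1) / 8) :
    ∫⁻ θ, ENNReal.ofReal (‖layerOutput σ θ x l hl‖ ^ 2) ^ p ∂(initLaw H m cw cb) ≤
      ENNReal.ofReal (Real.exp (∑ k ∈ Finset.range l, 8 * p / (m (k + 1) : ℝ)) *
        affineIter (γ * cw / 2) (γ * cb / 2 + B) l) ^ p := by
  induction l with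
  | zero => simp [layerOutput, hx, affineIter]
  | succ l ih =>
    have ih' := ih (by omega) (fun k hk => hm k (by omega)) fun k hk => hp k (by omega)
    have ha := affineIter_nonneg (r := γ * cw / 2) (β := γ * cb / 2 + B) (by positivity)
      (by positivity) l
    refine (moment_succ hσ hγ hB hσB cw cb (by omega) (hm l (by omega)) hp1 (hp l (by omega)) x
      (by positivity) ih').trans ?_
    refine pow_le_pow_left' (ENNReal.ofReal_le_ofReal ?_) p
    rw [Finset.sum_range_succ, Real.exp_add]
    simp only [affineIter, momentFactor]
    set e := Real.exp (8 * p / (m (l + 1) : ℝ))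
    set s := Real.exp (∑ k ∈ Finset.range l, 8 * p / (m (k + 1) : ℝ))
    -- Both exponentials are at least one, so they may be attached to the additive terms and pulled
    -- out of the recursion.
    have he : 1 ≤ e := Real.one_le_exp (by positivity)
    have hs : 1 ≤ s := Real.one_le_exp (Finset.sum_nonneg fun _ _ => by positivity)
    have hes : 1 ≤ s * e := one_le_mul_of_one_le_of_one_le hs he
    have h1 : e * (γ * cb / 2) ≤ s * e * (γ * cb / 2) := by
      refine mul_le_mul_of_nonneg_right ?_ (by positivity)
      exact le_mul_of_one_le_left (by positivity) hs
    have h2 : B ≤ s * e * B := le_mul_of_one_le_left hB hes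
    calc _ = s * e * (γ * cw / 2 * affineIter (γ * cw / 2) (γ * cb / 2 + B) l) +
          e * (γ * cb / 2) + B := by ring
      _ ≤ s * e * (γ * cw / 2 * affineIter (γ * cw / 2) (γ * cb / 2 + B) l) +
          s * e * (γ * cb / 2) + s * e * B := by gcongr
      _ = _ := by ring

end MarginBound

/-! ### The mean squared norm of the last hidden layer -/

namespace MarginBound

open scoped ENNReal NNReal

/-! ### Quadratic growth of the activation. -/

section Activation

variable {σ : ℝ → ℝ}

/-- Monotonicity and the limit at `-∞` bound `σ` from below; on the right the Lipschitz property
limits growth to slope one. -/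
lemma exists_abs_activation_le (hσ : IsActivation σ) : ∃ a, 0 ≤ a ∧ ∀ u, |σ u| ≤ a + max u 0 := by
  obtain ⟨s, hs⟩ := hσ.limBot
  have hlow : ∀ u, s ≤ σ u := fun u => hσ.mono.le_of_tendsto hs u
  refine ⟨|s| + |σ 0|, by positivity, fun u => ?_⟩
  have hup : σ u ≤ σ 0 + max u 0 := by
    rcases le_total u 0 with h | h
    · linarith [hσ.mono h, le_max_right u 0]
    · have := hσ.lipschitz.dist_le_mul u 0
      simp only [NNReal.coe_one, one_mul, Real.dist_eq, sub_zero] at this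
      rw [abs_of_nonneg h] at this
      linarith [le_abs_self (σ u - σ 0), le_max_left u 0]
  rw [abs_le]
  have := neg_abs_le s
  have := abs_nonneg (σ 0)
  have := le_abs_self (σ 0)
  have := abs_nonneg s
  have := hlow u
  have := le_max_right u 0
  constructor <;> linarith

/-- Squared activations grow like `γ u₊²`, where `γ c_w / 2 < 1` if `c_w < 2` or if the activation
is bounded. -/
lemma exists_sq_activation_le (hσ : IsActivation σ) (cw : ℝ≥0) :
    ∃ γ B : ℝ, 0 ≤ γ ∧ 0 ≤ B ∧ (∀ u, σ u ^ 2 ≤ γ * (max u 0) ^ 2 + B) ∧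
      ((cw < 2 ∨ BddAbove (Set.range σ)) → γ * cw / 2 < 1) := by
  obtain ⟨a, ha0, ha⟩ := exists_abs_activation_le hσ
  -- Young's inequality brings the coefficient of the square as close to one as desired.
  have key : ∀ ε : ℝ, 0 < ε → ∀ u, σ u ^ 2 ≤ (1 + ε) * (max u 0) ^ 2 + (1 + 1 / ε) * a ^ 2 := by
    intro ε hε u
    have h1 : σ u ^ 2 ≤ (a + max u 0) ^ 2 := sq_le_sq' (by linarith [(abs_le.1 (ha u)).1])
      (abs_le.1 (ha u)).2
    set w := max u 0
    have h2 : 0 ≤ (ε * w - a) ^ 2 / ε := by positivity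
    have h3 : (ε * w - a) ^ 2 / ε = ε * w ^ 2 - 2 * a * w + 1 / ε * a ^ 2 := by
      field_simp
      ring
    nlinarith
  by_cases hb : BddAbove (Set.range σ)
  · obtain ⟨b, hb⟩ := hb
    obtain ⟨s, hs⟩ := hσ.limBot
    refine ⟨0, (|s| + |b|) ^ 2, le_rfl, by positivity, fun u => ?_, fun _ => by norm_num⟩
    have h1 : s ≤ σ u := hσ.mono.le_of_tendsto hs u
    have h2 : σ u ≤ b := hb ⟨u, rfl⟩
    rw [zero_mul, zero_add]
    have := neg_abs_le s
    have := abs_nonneg s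
    have := abs_nonneg b
    have := le_abs_self b
    exact sq_le_sq' (by linarith) (by linarith)
  by_cases hc : cw < 2
  · have hc' : (cw : ℝ) < 2 := by exact_mod_cast hc
    -- With this `ε`, `γ c_w / 2 < 1` amounts to `(2 - c_w)(4 - c_w) > 0`.
    set ε : ℝ := (2 - cw) / 4 with hε
    have hε0 : 0 < ε := by rw [hε]; linarith
    refine ⟨1 + ε, (1 + 1 / ε) * a ^ 2, by positivity, by positivity, key ε hε0, fun _ => ?_⟩
    rw [hε]
    have := cw.coe_nonneg
    nlinarith
  · exact ⟨1 + 1, (1 + 1 / 1) * a ^ 2, by positivity, by positivity, key 1 one_pos, fun h =>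
      absurd h (by tauto)⟩

end Activation

variable {H : ℕ} {m : ℕ → ℕ} {σ : ℝ → ℝ} {Z : Type} [MeasurableSpace Z]

/-- The mean squared norm of a hidden layer over the data distribution. -/
def meanSq (σ : ℝ → ℝ) (D : Measure Z) (ξ : Z → EuclideanSpace ℝ (Fin (m 0))) (l : ℕ) (hl : l ≤ H)
    (θ : Params H m) : ℝ≥0∞ :=
  ∫⁻ z, ENNReal.ofReal (‖layerOutput σ θ (ξ z) l hl‖ ^ 2) ∂D

lemma measurable_layerOutput_comp (hσ : Continuous σ) {ξ : Z → EuclideanSpace ℝ (Fin (m 0))}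
    (hξ : Measurable ξ) (l : ℕ) (hl : l ≤ H) :
    Measurable fun p : Params H m × Z => layerOutput σ p.1 (ξ p.2) l hl :=
  (continuous_layerOutput hσ l hl).measurable.comp
    (measurable_fst.prodMk (hξ.comp measurable_snd))

lemma measurable_ofReal_norm_sq (hσ : Continuous σ) {ξ : Z → EuclideanSpace ℝ (Fin (m 0))}
    (hξ : Measurable ξ) (l : ℕ) (hl : l ≤ H) :
    Measurable fun p : Params H m × Z =>
      ENNReal.ofReal (‖layerOutput σ p.1 (ξ p.2) l hl‖ ^ 2) :=
  ((measurable_layerOutput_comp hσ hξ l hl).norm.pow_const 2).ennreal_ofReal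

lemma measurable_meanSq (hσ : Continuous σ) (D : Measure Z) [SFinite D]
    {ξ : Z → EuclideanSpace ℝ (Fin (m 0))} (hξ : Measurable ξ) (l : ℕ) (hl : l ≤ H) :
    Measurable (meanSq (H := H) σ D ξ l hl) :=
  (measurable_ofReal_norm_sq hσ hξ l hl).lintegral_prod_right'

/-- A fixed family of inputs of a random layer has bounded mean squared pre-activations, up to an
event of probability `r^{-p}`. -/
lemma measure_lintegral_preAct_le (cw cb : ℝ≥0) {l p : ℕ} (hm : 1 ≤ m (l + 1)) (hp1 : 1 ≤ p)
    (hp : p = 1 ∨ (p : ℝ) ≤ m (l + 1) / 8) (D : Measure Z) [IsProbabilityMeasure D]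
    {v : Z → EuclideanSpace ℝ (Fin (m l))} (hvm : Measurable v) {c₁ r : ℝ} (hc₁ : 0 ≤ c₁)
    (hr : 0 < r) (hv : ∫⁻ z, ENNReal.ofReal (‖v z‖ ^ 2) ∂D ≤ ENNReal.ofReal c₁) :
    layerLaw m cw cb l {a | ENNReal.ofReal ((cw * c₁ + cb + 1) * momentFactor p (m (l + 1)) * r) <
      ∫⁻ z, ENNReal.ofReal (posAvg (preAct a (v z))) ∂D} ≤ (ENNReal.ofReal r)⁻¹ ^ p := by
  have hX := momentFactor_pos p (m (l + 1))
  set X := momentFactor p (m (l + 1))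
  -- The added one keeps the weights `s` positive even for zero variances, as the division by them
  -- in `lintegral_lintegral_pow_le` requires.
  set c' : ℝ := cw * c₁ + cb + 1 with hc'
  have hc'0 : 0 < c' := by positivity
  set f : Z → LayerParams m l → ℝ≥0∞ := fun z a => ENNReal.ofReal (posAvg (preAct a (v z))) with hf
  have hfm : Measurable (Function.uncurry f) :=
    (measurable_posAvg.comp (measurable_preAct.comp
      (measurable_snd.prodMk (hvm.comp measurable_fst)))).ennreal_ofReal
  set s : Z → ℝ≥0∞ := fun z => ENNReal.ofReal (cw * ‖v z‖ ^ 2 + cb + 1) with hs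
  have hsm : Measurable s := by fun_prop
  have hs1 : ∫⁻ z, s z ∂D ≤ ENNReal.ofReal c' := by
    have e1 : ∀ z, s z = ENNReal.ofReal cw * ENNReal.ofReal (‖v z‖ ^ 2) +
        ENNReal.ofReal (cb + 1) := fun z => by
      rw [← ENNReal.ofReal_mul (by positivity), ← ENNReal.ofReal_add (by positivity)
        (by positivity), ← add_assoc]
    simp_rw [e1]
    rw [lintegral_add_right _ measurable_const, lintegral_const_mul _ (by fun_prop),
      lintegral_const, measure_univ, mul_one, hc', add_assoc,
      ENNReal.ofReal_add (p := cw * c₁) (by positivity) (by positivity),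
      ENNReal.ofReal_mul (p := (cw : ℝ)) (by positivity)]
    gcongr
  have hmom : ∫⁻ a, (∫⁻ z, f z a ∂D) ^ p ∂(layerLaw m cw cb l) ≤ ENNReal.ofReal (c' * X) ^ p := by
    refine (lintegral_lintegral_pow_le hfm hsm (fun z => ?_) (fun z => ENNReal.ofReal_ne_top) hp1
      (R := ENNReal.ofReal X ^ p) (Eventually.of_forall fun z => ?_)).trans ?_
    · rw [hs]
      simp only [ne_eq, ENNReal.ofReal_eq_zero, not_le]
      positivity
    · refine (lintegral_posAvg_preAct_pow_le cw cb hm hp (v z)).trans ?_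
      rw [mul_pow]
      gcongr
      simp only [hs]
      exact ENNReal.ofReal_le_ofReal (by linarith)
    · rw [ENNReal.ofReal_mul hc'0.le, mul_pow]
      gcongr
  have hmk := measure_le_of_moment (μ := layerLaw m cw cb l)
    (f := fun a => ∫⁻ z, f z a ∂D) (hfm.lintegral_prod_left') (r := ENNReal.ofReal r)
    (by simp only [ne_eq, ENNReal.ofReal_eq_zero, not_le]; positivity) ENNReal.ofReal_ne_top
    (by simpa using hr) ENNReal.ofReal_ne_top hmom
  rwa [← ENNReal.ofReal_mul (by positivity)] at hmk

/-- Control of the mean squared norm of a layer by that of the previous one, up to an event of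
probability `r^{-p}`. -/
lemma measure_meanSq_succ_le (hσ : Continuous σ) {γ B : ℝ} (hγ : 0 ≤ γ) (hB : 0 ≤ B)
    (hσB : ∀ u, σ u ^ 2 ≤ γ * (max u 0) ^ 2 + B) (cw cb : ℝ≥0) {l p : ℕ} (hl : l < H)
    (hm : 1 ≤ m (l + 1)) (hp1 : 1 ≤ p) (hp : p = 1 ∨ (p : ℝ) ≤ m (l + 1) / 8)
    (D : Measure Z) [IsProbabilityMeasure D] {ξ : Z → EuclideanSpace ℝ (Fin (m 0))}
    (hξ : Measurable ξ) {c₁ r : ℝ} (hc₁ : 0 ≤ c₁) (hr : 0 < r) :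
    initLaw H m cw cb {θ | ENNReal.ofReal
        (γ * ((cw * c₁ + cb + 1) * momentFactor p (m (l + 1)) * r) + B) <
          meanSq σ D ξ (l + 1) hl θ} ≤
      initLaw H m cw cb {θ | ENNReal.ofReal c₁ < meanSq σ D ξ l hl.le θ} +
        (ENNReal.ofReal r)⁻¹ ^ p := by
  set L : Fin (H + 1) := ⟨l, by omega⟩ with hL
  have hX := momentFactor_pos p (m (l + 1))
  set c' : ℝ := (cw * c₁ + cb + 1) * momentFactor p (m (l + 1)) * r with hc'
  have hc'0 : 0 < c' := by positivity
  set S : Set (Params H m) := {θ | ENNReal.ofReal (γ * c' + B) <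
    meanSq σ D ξ (l + 1) hl θ} with hS
  set T : Set (Params H m) := {θ | ENNReal.ofReal c₁ < meanSq σ D ξ l hl.le θ} with hT
  have hSm : MeasurableSet S := measurableSet_lt measurable_const (measurable_meanSq hσ D hξ _ _)
  have hTm : MeasurableSet T := measurableSet_lt measurable_const (measurable_meanSq hσ D hξ _ _)
  have hcong : ∀ (a : LayerParams m L) (b : ∀ j : Fin H, LayerParams m (L.succAbove j)),
      meanSq σ D ξ l hl.le (assemble L a b) = meanSq σ D ξ l hl.le (assemble L 0 b) := by
    intro a b
    refine lintegral_congr fun z => ?_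
    rw [layerOutput_congr (θ := assemble L a b) (θ' := assemble L 0 b) (ξ z) l hl.le fun k hk =>
      assemble_ne _ _ _ _ _ fun h => by rw [h] at hk; simp [hL] at hk]
  have hTcong : ∀ (a : LayerParams m L) (b : ∀ j : Fin H, LayerParams m (L.succAbove j)),
      T.indicator (1 : Params H m → ℝ≥0∞) (assemble L a b) =
        T.indicator 1 (assemble L 0 b) := fun a b => by
    have : (assemble L a b ∈ T) ↔ (assemble L 0 b ∈ T) := by
      simp only [hT, Set.mem_ofPred_eq, hcong a b]
    by_cases h : assemble L 0 b ∈ T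
    · rw [Set.indicator_of_mem (this.2 h), Set.indicator_of_mem h]
      rfl
    · rw [Set.indicator_of_notMem (fun h' => h (this.1 h')), Set.indicator_of_notMem h]
  rw [← lintegral_indicator_one hSm, ← lintegral_indicator_one hTm,
    lintegral_initLaw cw cb L (measurable_one.indicator hSm),
    lintegral_initLaw cw cb L (measurable_one.indicator hTm)]
  simp_rw [hTcong]
  -- With the other layers frozen at `b`, either the previous layer is already bad and the trivial
  -- bound one suffices, or its outputs are a fixed family to which `measure_lintegral_preAct_le`
  -- applies.
  have hin : ∀ b, ∫⁻ a, S.indicator 1 (assemble L a b) ∂(layerLaw m cw cb L) ≤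
      T.indicator 1 (assemble L 0 b) + (ENNReal.ofReal r)⁻¹ ^ p := by
    intro b
    by_cases hb : assemble L 0 b ∈ T
    · rw [Set.indicator_of_mem hb]
      calc _ ≤ ∫⁻ _a, 1 ∂(layerLaw m cw cb L) :=
            lintegral_mono fun a => Set.indicator_le_self' (fun _ _ => zero_le_one) _
        _ = 1 := by simp
        _ ≤ _ := le_self_add
    rw [Set.indicator_of_notMem hb, zero_add]
    have hb' : meanSq σ D ξ l hl.le (assemble L 0 b) ≤ ENNReal.ofReal c₁ := not_lt.1 hb
    set v : Z → EuclideanSpace ℝ (Fin (m l)) := fun z =>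
      layerOutput σ (assemble L 0 b) (ξ z) l hl.le with hv
    have hvm : Measurable v := (measurable_layerOutput_comp hσ hξ l hl.le).comp measurable_prodMk_left
    have hmk := measure_lintegral_preAct_le cw cb hm hp1 hp D hvm hc₁ hr hb'
    have hAm : MeasurableSet {a : LayerParams m l | assemble L a b ∈ S} :=
      hSm.preimage ((measurable_assemble L).comp measurable_prodMk_right)
    have hSA : ∫⁻ a, S.indicator 1 (assemble L a b) ∂(layerLaw m cw cb L) =
        layerLaw m cw cb l {a | assemble L a b ∈ S} := by
      rw [← lintegral_indicator_one hAm]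
      rfl
    rw [hSA]
    refine le_trans (measure_mono fun a ha => ?_) hmk
    rw [Set.mem_ofPred_eq] at ha ⊢
    rw [hS, Set.mem_ofPred_eq] at ha
    by_contra hcon
    rw [not_lt] at hcon
    refine absurd ha (not_lt.2 ?_)
    have hpt : ∀ z, ENNReal.ofReal (‖layerOutput σ (assemble L a b) (ξ z) (l + 1) hl‖ ^ 2) ≤
        ENNReal.ofReal γ * ENNReal.ofReal (posAvg (preAct a (v z))) + ENNReal.ofReal B := fun z => by
      rw [← ENNReal.ofReal_mul hγ, ← ENNReal.ofReal_add (mul_nonneg hγ (posAvg_nonneg _)) hB]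
      exact ENNReal.ofReal_le_ofReal (norm_sq_layerOutput_succ_le hσB l hl hm a 0 b (ξ z))
    have hfm : Measurable fun z => ENNReal.ofReal (posAvg (preAct a (v z))) :=
      (measurable_posAvg.comp (measurable_preAct.comp
        (measurable_const.prodMk hvm))).ennreal_ofReal
    refine (lintegral_mono hpt).trans ?_
    rw [lintegral_add_right _ measurable_const, lintegral_const_mul _ hfm, lintegral_const,
      measure_univ, mul_one, ENNReal.ofReal_add (by positivity) hB, ENNReal.ofReal_mul hγ]
    gcongr
  refine (lintegral_mono hin).trans ?_
  rw [lintegral_add_right _ measurable_const]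
  simp

/-- With high probability the mean squared norm of a hidden layer is at most the bound on its
`p`-norm times `r`. -/
lemma measure_meanSq_le (hσ : Continuous σ) (cw cb : ℝ≥0) {l p : ℕ} (hl : l ≤ H) (hp1 : 1 ≤ p)
    (D : Measure Z) [IsProbabilityMeasure D] {ξ : Z → EuclideanSpace ℝ (Fin (m 0))}
    (hξ : Measurable ξ) {M r : ℝ} (hM : 0 < M) (hr : 0 < r)
    (hmom : ∀ᵐ z ∂D, ∫⁻ θ, ENNReal.ofReal (‖layerOutput σ θ (ξ z) l hl‖ ^ 2) ^ p
      ∂(initLaw H m cw cb) ≤ ENNReal.ofReal M ^ p) :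
    initLaw H m cw cb {θ | ENNReal.ofReal (M * r) < meanSq σ D ξ l hl θ} ≤
      (ENNReal.ofReal r)⁻¹ ^ p := by
  have hsw : Measurable (Function.uncurry fun (z : Z) (θ : Params H m) =>
      ENNReal.ofReal (‖layerOutput σ θ (ξ z) l hl‖ ^ 2)) := by
    have := (continuous_layerOutput hσ l hl).measurable.comp
      ((measurable_snd (α := Z) (β := Params H m)).prodMk (hξ.comp measurable_fst))
    exact (this.norm.pow_const 2).ennreal_ofReal
  have hj := lintegral_lintegral_pow_le (μ := initLaw H m cw cb) (D := D) hsw (s := fun _ => 1)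
    measurable_const (fun _ => one_ne_zero) (fun _ => ENNReal.one_ne_top) hp1
    (R := ENNReal.ofReal M ^ p) (by simpa using hmom)
  simp only [lintegral_const, measure_univ, mul_one, one_pow, one_mul] at hj
  rw [ENNReal.ofReal_mul hM.le]
  exact measure_le_of_moment (measurable_meanSq hσ D hξ l hl) (by simpa using hM)
    ENNReal.ofReal_ne_top (by simpa using hr) ENNReal.ofReal_ne_top hj

lemma inv_ofReal_exp_pow (x : ℝ) (p : ℕ) :
    (ENNReal.ofReal (Real.exp x))⁻¹ ^ p = ENNReal.ofReal (Real.exp (-(p * x))) := by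
  rw [← ENNReal.ofReal_inv_of_pos (Real.exp_pos _), ← ENNReal.ofReal_pow (by positivity),
    ← Real.exp_neg, ← Real.exp_nat_mul]
  congr 2; ring

/-- Moment orders are rounded up to integers; the last alternative matches the condition `p = 1 ∨ p
≤ m / 8` of the moment bounds. -/
lemma ceil_eq_one_or_le {t : ℝ} (ht : 0 < t) : 1 ≤ ⌈t⌉₊ ∧ t ≤ ⌈t⌉₊ ∧ (⌈t⌉₊ : ℝ) ≤ t + 1 ∧
    (⌈t⌉₊ = 1 ∨ (⌈t⌉₊ : ℝ) ≤ 2 * t) := by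
  have h1 : 1 ≤ ⌈t⌉₊ := Nat.one_le_ceil_iff.2 ht
  have h3 : (⌈t⌉₊ : ℝ) ≤ t + 1 := (Nat.ceil_lt_add_one ht.le).le
  refine ⟨h1, Nat.le_ceil t, h3, ?_⟩
  rcases le_or_gt t 1 with h | h
  · left
    exact le_antisymm (Nat.ceil_le.2 (by simpa using h)) h1
  · right; linarith

/-- With high probability over the initial parameters, the mean squared norm of the last hidden
layer is bounded by a constant. -/
theorem exists_meanSq_bound (hσ : IsActivation σ) (cw cb : ℝ≥0) {C : ℝ} (hC : 0 < C) :
    ∃ c : ℕ → ℝ, (∀ H, 0 < c H) ∧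
      ((cw < 2 ∨ BddAbove (Set.range σ)) → ∀ H H' : ℕ, c H = c H') ∧
      ∀ (H n : ℕ) (m : ℕ → ℕ) (δ : ℝ), 2 ≤ H → 1 ≤ n → 0 < δ → δ < 1 →
        (∀ l : ℕ, 1 ≤ l → l ≤ H - 2 →
          C * (H : ℝ) ^ 2 * Real.log ((H : ℝ) * (n : ℝ) ^ 2 / δ) ≤ (m l : ℝ)) →
        C * Real.log ((H : ℝ) * (n : ℝ) ^ 2 / δ) ≤ (m (H - 1) : ℝ) →
        C * (n : ℝ) ≤ (m H : ℝ) →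
        ∀ (Z : Type) [MeasurableSpace Z] (D : Measure Z) [IsProbabilityMeasure D]
          (ξ : Z → EuclideanSpace ℝ (Fin (m 0))), Measurable ξ → (∀ᵐ z ∂D, ‖ξ z‖ = 1) →
          initLaw H m cw cb {θ | ENNReal.ofReal (c H) < meanSq σ D ξ H le_rfl θ} ≤
            ENNReal.ofReal δ + ENNReal.ofReal (Real.exp (-(2 * n))) := by
  classical
  obtain ⟨γ, B, hγ, hB, hσB, hγ1⟩ := exists_sq_activation_le hσ cw
  have hσc : Continuous σ := hσ.lipschitz.continuous
  set r : ℝ := γ * cw / 2 with hr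
  set β : ℝ := γ * cb / 2 + B with hβ
  have hr0 : 0 ≤ r := by positivity
  have hβ0 : 0 ≤ β := by positivity
  -- In the subcritical case the fixed-point bound replaces the iterate, so the constant loses its
  -- dependence on `H`.
  set A : ℕ → ℝ := fun H => if cw < 2 ∨ BddAbove (Set.range σ) then 1 + β / (1 - r)
    else affineIter r β (H - 1) + 1 with hA
  have hA0 : ∀ H, 0 < A H := fun H => by
    simp only [hA]
    split_ifs with h
    · have : 0 < 1 - r := by linarith [hγ1 h]
      positivity
    · have := affineIter_nonneg hr0 hβ0 (H - 1)
      positivity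
  have hAle : ∀ H, affineIter r β (H - 1) ≤ A H := fun H => by
    simp only [hA]
    split_ifs with h
    · exact affineIter_le hr0 hβ0 (hγ1 h) _
    · linarith
  -- With this `κ`, twice the order `κ Lg` is at most one eighth of a width `C Lg`; likewise for `κ
  -- n` and `C n`.
  set κ : ℝ := C / 16 with hκ
  have hκ0 : 0 < κ := by positivity
  set S : ℝ := 16 * (κ + 2) / C with hS
  set K : ℝ := Real.exp (8 * (κ + 1) / C) / 2 with hK
  set c₁ : ℕ → ℝ := fun H => Real.exp S * A H * Real.exp (1 / κ) with hc₁
  have hc₁0 : ∀ H, 0 < c₁ H := fun H => by have := hA0 H; simp only [hc₁]; positivity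
  refine ⟨fun H => γ * ((cw * c₁ H + cb + 1) * K * Real.exp (2 / κ)) + B + 1, fun H => ?_,
    fun h H H' => ?_, ?_⟩
  · have := hc₁0 H
    positivity
  · simp only [hc₁, hA, if_pos h]
  intro H n m δ hH hn hδ hδ1 hm hm1 hmH Z _ D _ ξ hξ hξ1
  have hHr : (2 : ℝ) ≤ H := by exact_mod_cast hH
  have hnr : (1 : ℝ) ≤ n := by exact_mod_cast hn
  set Lg : ℝ := Real.log ((H : ℝ) * (n : ℝ) ^ 2 / δ) with hLg
  have hn2 : (1 : ℝ) ≤ (n : ℝ) ^ 2 := one_le_pow₀ hnr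
  have harg : 2 ≤ (H : ℝ) * (n : ℝ) ^ 2 / δ := by
    rw [le_div_iff₀ hδ]
    nlinarith
  -- A lower bound on `Lg` absorbs the rounding error of `p` into a multiple of `Lg`, giving `hpL`.
  have hLg2 : 1 / 2 ≤ Lg := by
    have h1 := Real.log_le_log two_pos harg
    have h2 := Real.log_two_gt_d9
    linarith
  have hLg0 : 0 < Lg := by linarith
  have hexpL : Real.exp (-Lg) ≤ δ := by
    rw [Real.exp_neg, hLg, Real.exp_log (by linarith), inv_div, div_le_iff₀ (by positivity)]
    have : 1 ≤ (H : ℝ) * (n : ℝ) ^ 2 := by nlinarith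
    exact le_mul_of_one_le_right hδ.le this
  obtain ⟨hp1, hpl, hpu, hp2⟩ := ceil_eq_one_or_le (t := κ * Lg) (by positivity)
  set p := ⌈κ * Lg⌉₊
  have hpL : (p : ℝ) ≤ (κ + 2) * Lg := by linarith
  have hH2 : (1 : ℝ) ≤ (H : ℝ) ^ 2 := one_le_pow₀ (by linarith)
  have hwidth : ∀ k < H - 1, C * Lg ≤ m (k + 1) := by
    intro k hk
    by_cases hk2 : k + 1 ≤ H - 2
    · refine le_trans ?_ (hm (k + 1) (by omega) hk2)
      rw [mul_right_comm]
      exact le_mul_of_one_le_right (by positivity) hH2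
    · rwa [show k + 1 = H - 1 by omega]
  have hwpos : ∀ k < H - 1, (0 : ℝ) < m (k + 1) := fun k hk =>
    lt_of_lt_of_le (by positivity) (hwidth k hk)
  -- Layer `H - 1` contributes one bounded term. Each earlier layer contributes `O(1/H)`, for which
  -- one of the two factors `H` in its width suffices.
  have hsum : ∑ k ∈ Finset.range (H - 1), 8 * p / (m (k + 1) : ℝ) ≤ S := by
    obtain ⟨h, rfl⟩ : ∃ h, H = h + 2 := ⟨H - 2, by omega⟩
    rw [show h + 2 - 1 = h + 1 by omega, Finset.sum_range_succ]
    have hlast : 8 * p / (m (h + 1) : ℝ) ≤ 8 * (κ + 2) / C := by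
      have h1 := hwidth h (by omega)
      have h2 := hwpos h (by omega)
      rw [div_le_div_iff₀ h2 hC]
      calc 8 * (p : ℝ) * C ≤ 8 * ((κ + 2) * Lg) * C := by gcongr
        _ = 8 * (κ + 2) * (C * Lg) := by ring
        _ ≤ _ := by gcongr
    have hrest : ∀ k ∈ Finset.range h, 8 * p / (m (k + 1) : ℝ) ≤
        8 * (κ + 2) / C / ((h + 2 : ℕ) : ℝ) := by
      intro k hk
      have hk' := Finset.mem_range.1 hk
      have h1 := hm (k + 1) (by omega) (by omega)
      have h2 := hwpos k (by omega)
      rw [div_div, div_le_div_iff₀ h2 (by positivity)]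
      set N : ℝ := ((h + 2 : ℕ) : ℝ)
      calc 8 * (p : ℝ) * (C * N) ≤ 8 * ((κ + 2) * Lg) * (C * N) := by gcongr
        _ = 8 * (κ + 2) * (C * N * Lg) := by ring
        _ ≤ 8 * (κ + 2) * (C * N ^ 2 * Lg) := by
            gcongr
            nlinarith
        _ ≤ _ := by gcongr
    have hs := Finset.sum_le_sum hrest
    rw [Finset.sum_const, Finset.card_range, nsmul_eq_mul] at hs
    have hfrac : (h : ℝ) * (8 * (κ + 2) / C / ((h + 2 : ℕ) : ℝ)) ≤ 8 * (κ + 2) / C := by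
      rw [mul_div_assoc', div_le_iff₀ (by positivity), mul_comm]
      gcongr
      linarith
    have : S = 8 * (κ + 2) / C + 8 * (κ + 2) / C := by rw [hS]; ring
    linarith
  have hlayer : ∀ᵐ z ∂D, ∫⁻ θ, ENNReal.ofReal (‖layerOutput σ θ (ξ z) (H - 1) (by omega)‖ ^ 2) ^ p
      ∂(initLaw H m cw cb) ≤ ENNReal.ofReal (Real.exp S * A H) ^ p := by
    filter_upwards [hξ1] with z hz
    refine (moment_le hσc hγ hB hσB cw cb hp1 (ξ z) hz (H - 1) (by omega)
      (fun k hk => by exact_mod_cast hwpos k hk) fun k hk => ?_).trans ?_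
    · refine hp2.imp id fun h => h.trans ?_
      have := hwidth k hk
      rw [hκ]; linarith
    · refine pow_le_pow_left' (ENNReal.ofReal_le_ofReal ?_) p
      exact mul_le_mul (Real.exp_le_exp.2 hsum) (hAle H) (affineIter_nonneg hr0 hβ0 _)
        (Real.exp_pos _).le
  have hfirst := measure_meanSq_le hσc cw cb (by omega) hp1 D hξ
    (mul_pos (Real.exp_pos S) (hA0 H)) (Real.exp_pos (1 / κ)) hlayer
  rw [inv_ofReal_exp_pow] at hfirst
  -- Exceeding the `p`-norm by `e^{1/κ}` has probability at most `e^{-p/κ} ≤ e^{-Lg} ≤ δ`.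
  have hfirst' : ENNReal.ofReal (Real.exp (-(p * (1 / κ)))) ≤ ENNReal.ofReal δ := by
    refine ENNReal.ofReal_le_ofReal (le_trans (Real.exp_le_exp.2 (neg_le_neg ?_)) hexpL)
    rw [mul_one_div, le_div_iff₀ hκ0]; linarith
  obtain ⟨l, rfl⟩ : ∃ l, H = l + 1 := ⟨H - 1, by omega⟩
  simp only [Nat.add_sub_cancel] at hfirst
  obtain ⟨hq1, hql, hqu, hq2⟩ := ceil_eq_one_or_le (t := κ * n) (by positivity)
  set q := ⌈κ * n⌉₊
  have hmH0 : (0 : ℝ) < m (l + 1) := lt_of_lt_of_le (by positivity) hmH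
  -- The last layer uses order `q` about `κ n`; the factor `e^{2/κ}` makes the extra failure
  -- probability `e^{-2q/κ} ≤ e^{-2n}`.
  have hlast := measure_meanSq_succ_le hσc hγ hB hσB cw cb (l := l) (p := q) (Nat.lt_succ_self l)
    (by exact_mod_cast hmH0) hq1 (hq2.imp id fun h => h.trans (by rw [hκ]; linarith)) D hξ
    (hc₁0 (l + 1)).le (Real.exp_pos (2 / κ))
  rw [inv_ofReal_exp_pow] at hlast
  have hX : momentFactor q (m (l + 1)) ≤ K := by
    refine div_le_div_of_nonneg_right (Real.exp_le_exp.2 ?_) zero_le_two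
    rw [div_le_iff₀ hmH0]
    calc (8 : ℝ) * q ≤ 8 * ((κ + 1) * n) := by gcongr; nlinarith
      _ = 8 * (κ + 1) / C * (C * n) := by field_simp
      _ ≤ _ := by gcongr
  have hfinal : initLaw (l + 1) m cw cb {θ | ENNReal.ofReal
      (γ * ((cw * c₁ (l + 1) + cb + 1) * K * Real.exp (2 / κ)) + B + 1) <
        meanSq σ D ξ (l + 1) le_rfl θ} ≤
      initLaw (l + 1) m cw cb {θ | ENNReal.ofReal (γ * ((cw * c₁ (l + 1) + cb + 1) *
        momentFactor q (m (l + 1)) * Real.exp (2 / κ)) + B) < meanSq σ D ξ (l + 1) le_rfl θ} := by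
    refine measure_mono fun θ hθ => lt_of_le_of_lt (ENNReal.ofReal_le_ofReal ?_) hθ
    have h1 : γ * ((cw * c₁ (l + 1) + cb + 1) * momentFactor q (m (l + 1)) * Real.exp (2 / κ)) ≤
        γ * ((cw * c₁ (l + 1) + cb + 1) * K * Real.exp (2 / κ)) := by
      have := (hc₁0 (l + 1)).le
      gcongr
    linarith
  refine hfinal.trans (hlast.trans (add_le_add (hfirst.trans hfirst') ?_))
  refine ENNReal.ofReal_le_ofReal (Real.exp_le_exp.2 (neg_le_neg ?_))
  rw [mul_div_assoc', le_div_iff₀ hκ0]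
  linarith

end MarginBound

/-! ### Margin losses of linear predictors -/

namespace MarginBound

open scoped ENNReal NNReal

section Losses

variable {K : ℕ}

lemma marginLoss_nonneg (ρ : ℝ) (q : EuclideanSpace ℝ (Fin K)) (k : Fin K) :
    0 ≤ marginLoss ρ q k := le_min (le_max_right _ _) zero_le_one

lemma marginLoss_le_one (ρ : ℝ) (q : EuclideanSpace ℝ (Fin K)) (k : Fin K) :
    marginLoss ρ q k ≤ 1 := min_le_right _ _

lemma abs_marginLoss_le_one (ρ : ℝ) (q : EuclideanSpace ℝ (Fin K)) (k : Fin K) :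
    |marginLoss ρ q k| ≤ 1 :=
  abs_le.2 ⟨by linarith [marginLoss_nonneg ρ q k], marginLoss_le_one ρ q k⟩

lemma nonempty_ne (hK : 2 ≤ K) (k : Fin K) : Nonempty {j : Fin K // j ≠ k} := by
  have : Nontrivial (Fin K) := Fin.nontrivial_iff_two_le.2 hK
  obtain ⟨j, hj⟩ := exists_ne k
  exact ⟨⟨j, hj⟩⟩

lemma zeroOneLoss_nonneg (q : EuclideanSpace ℝ (Fin K)) (k : Fin K) : 0 ≤ zeroOneLoss q k := by
  unfold zeroOneLoss; split_ifs <;> norm_num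

lemma zeroOneLoss_le_marginLoss {ρ : ℝ} (hρ : 0 < ρ) (q : EuclideanSpace ℝ (Fin K))
    (k : Fin K) : zeroOneLoss q k ≤ marginLoss ρ q k := by
  unfold zeroOneLoss
  split_ifs with h
  · exact marginLoss_nonneg ρ q k
  · push Not at h
    obtain ⟨j, hj, hq⟩ := h
    have h1 := le_ciSup_fin (fun j : {j : Fin K // j ≠ k} => q j) ⟨j, hj⟩
    have h2 : (q k - ⨆ j : {j : Fin K // j ≠ k}, q j) / ρ ≤ 0 :=
      div_nonpos_of_nonpos_of_nonneg (by simp only at h1; linarith) hρ.le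
    exact le_min (le_max_of_le_left (by linarith)) le_rfl

lemma abs_clip_sub_le (a b : ℝ) : |min (max a 0) 1 - min (max b 0) 1| ≤ |a - b| :=
  (abs_min_sub_min_le_max (max a 0) 1 (max b 0) 1).trans
    (max_le (abs_max_sub_max_le_abs a b 0) (by simp))

/-- The margin loss is `2/ρ`-Lipschitz in the maximum norm. -/
lemma exists_abs_marginLoss_sub_le (hK : 2 ≤ K) {ρ : ℝ} (hρ : 0 < ρ)
    (q q' : EuclideanSpace ℝ (Fin K)) (k : Fin K) :
    ∃ j, |marginLoss ρ q k - marginLoss ρ q' k| ≤ 2 / ρ * |q j - q' j| := by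
  have := nonempty_ne hK k
  have : Nonempty (Fin K) := ⟨k⟩
  -- The true score and the maximum of its competitors each move by at most the largest coordinate
  -- change, whence the factor two. An index attaining it is the form `contraction` requires.
  obtain ⟨j, hj⟩ := Finite.exists_max fun j => |q j - q' j|
  refine ⟨j, (abs_clip_sub_le _ _).trans ?_⟩
  have h1 := abs_ciSup_sub_le (f := fun i : {i : Fin K // i ≠ k} => q i) (g := fun i => q' i)
    fun i => hj i
  have h2 : 1 - (q k - ⨆ i : {i : Fin K // i ≠ k}, q i) / ρ -
      (1 - (q' k - ⨆ i : {i : Fin K // i ≠ k}, q' i) / ρ) =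
      (((⨆ i : {i : Fin K // i ≠ k}, q i) - ⨆ i : {i : Fin K // i ≠ k}, q' i) -
        (q k - q' k)) / ρ := by ring
  rw [h2, abs_div, abs_of_pos hρ, div_mul_eq_mul_div]
  gcongr
  have h3 := abs_sub ((⨆ i : {i : Fin K // i ≠ k}, q i) - ⨆ i : {i : Fin K // i ≠ k}, q' i)
    (q k - q' k)
  linarith [hj k]

lemma continuous_marginLoss (hK : 2 ≤ K) {ρ : ℝ} (hρ : 0 < ρ) (k : Fin K) :
    Continuous fun q : EuclideanSpace ℝ (Fin K) => marginLoss ρ q k := by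
  refine LipschitzWith.continuous (K := (2 / ρ).toNNReal) (LipschitzWith.of_dist_le_mul ?_)
  intro q q'
  obtain ⟨j, hj⟩ := exists_abs_marginLoss_sub_le hK hρ q q' k
  rw [Real.coe_toNNReal _ (by positivity), Real.dist_eq, dist_eq_norm]
  refine hj.trans (mul_le_mul_of_nonneg_left ?_ (by positivity))
  simpa using PiLp.norm_apply_le (q - q') j

lemma measurable_marginLoss (hK : 2 ≤ K) {ρ : ℝ} (hρ : 0 < ρ) :
    Measurable fun p : EuclideanSpace ℝ (Fin K) × Fin K => marginLoss ρ p.1 p.2 :=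
  measurable_from_prod_countable_left fun k => (continuous_marginLoss hK hρ k).measurable

lemma zeroOneLoss_zero (hK : 2 ≤ K) (k : Fin K) :
    zeroOneLoss (0 : EuclideanSpace ℝ (Fin K)) k = 1 := by
  obtain ⟨j, hj⟩ := nonempty_ne hK k
  rw [zeroOneLoss, if_neg]
  intro h
  simpa using h j hj

lemma marginLoss_zero (ρ : ℝ) (k : Fin K) : marginLoss ρ (0 : EuclideanSpace ℝ (Fin K)) k = 1 := by
  simp [marginLoss, Real.iSup_const_zero]

end Losses

section Predictors

variable {K : ℕ} {E : Type*} [NormedAddCommGroup E] [InnerProductSpace ℝ E]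

/-- The outputs of the linear predictor with weight rows `W` on the feature vector `v`. -/
def linOut (W : Fin K → E) (v : E) : EuclideanSpace ℝ (Fin K) :=
  WithLp.toLp 2 fun i => inner ℝ (W i) v

lemma continuous_linOut : Continuous fun p : (Fin K → E) × E => linOut p.1 p.2 := by
  unfold linOut; fun_prop

/-- The gap between the population and the empirical margin loss of a linear predictor. -/
def marginGap {Z : Type*} [MeasurableSpace Z] (D : Measure Z) (ρ : ℝ) (φ : Z → E) (y : Z → Fin K)
    {n : ℕ} (S : Fin n → Z) (W : Fin K → E) : ℝ :=
  ∫ z, marginLoss ρ (linOut W (φ z)) (y z) ∂D -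
    (1 / (n : ℝ)) * ∑ i, marginLoss ρ (linOut W (φ (S i))) (y (S i))

lemma marginGap_le_one {Z : Type*} [MeasurableSpace Z] (D : Measure Z)
    [IsProbabilityMeasure D] (ρ : ℝ) (φ : Z → E) (y : Z → Fin K) {n : ℕ} (S : Fin n → Z) (W : Fin K → E) : marginGap D ρ φ y S W ≤ 1 := by
  have h1 : ∫ z, marginLoss ρ (linOut W (φ z)) (y z) ∂D ≤ 1 :=
    (abs_le.1 (abs_integral_le_of_abs_le fun z => abs_marginLoss_le_one _ _ _)).2
  have h2 : 0 ≤ (1 / (n : ℝ)) * ∑ i, marginLoss ρ (linOut W (φ (S i))) (y (S i)) :=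
    mul_nonneg (by positivity) (Finset.sum_nonneg fun i _ => marginLoss_nonneg _ _ _)
  unfold marginGap
  linarith

variable {Z : Type*} [MeasurableSpace Z] [MeasurableSpace E] [BorelSpace E]

lemma measurable_marginLoss_linOut (hK : 2 ≤ K) {ρ : ℝ} (hρ : 0 < ρ) {φ : Z → E} {y : Z → Fin K}
    (hφ : Measurable φ) (hy : Measurable y) (W : Fin K → E) :
    Measurable fun z => marginLoss ρ (linOut W (φ z)) (y z) :=
  (measurable_marginLoss hK hρ).comp
    (((continuous_linOut.comp (Continuous.prodMk_right W)).measurable.comp hφ).prodMk hy)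

lemma continuous_marginGap (hK : 2 ≤ K) {ρ : ℝ} (hρ : 0 < ρ) (D : Measure Z)
    [IsProbabilityMeasure D] {φ : Z → E} {y : Z → Fin K} (hφ : Measurable φ) (hy : Measurable y)
    {n : ℕ} (S : Fin n → Z) : Continuous (marginGap D ρ φ y S) := by
  have hc : ∀ z, Continuous fun W : Fin K → E => marginLoss ρ (linOut W (φ z)) (y z) := fun z =>
    (continuous_marginLoss hK hρ (y z)).comp
      (continuous_linOut.comp (Continuous.prodMk_left (φ z)))
  refine Continuous.sub ?_ (continuous_const.mul (continuous_finsetSum _ fun i _ => hc _))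
  refine continuous_of_dominated (bound := fun _ => 1)
    (fun W => (measurable_marginLoss_linOut hK hρ hφ hy W).aestronglyMeasurable) (fun W => ?_)
    (integrable_const _) (Eventually.of_forall hc)
  exact Eventually.of_forall fun z => abs_marginLoss_le_one _ _ _

/-- Uniform deviation bound for the margin losses of a sequence of linear predictors. -/
lemma measure_exists_marginGap_gt_le (hK : 2 ≤ K) {ρ : ℝ} (hρ : 0 < ρ) (D : Measure Z)
    [IsProbabilityMeasure D] {φ : Z → E} {y : Z → Fin K} (hφ : Measurable φ) (hy : Measurable y)
    {n : ℕ} (hn : 1 ≤ n) (hφi : Integrable (fun z => ‖φ z‖ ^ 2) D) {B : ℝ} (hB : 0 < B)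
    (hφB : ∫ z, ‖φ z‖ ^ 2 ∂D ≤ B ^ 2) (W : ℕ → Fin K → E) {Λ : ℝ} (hΛ : 0 ≤ Λ)
    (hW : ∀ w k, ‖W w k‖ ≤ Λ) {ε : ℝ} (hε : 0 ≤ ε) :
    (Measure.pi fun _ : Fin n => D)
        {S | ∃ w, 2 * (2 / ρ) * Λ * K * B / √n + ε < marginGap D ρ φ y S (W w)} ≤
      ENNReal.ofReal (Real.exp (-(2 * n * ε ^ 2))) := by
  set V : ℕ → Set (Fin n → Z) := fun N => {S | ∃ w : Fin (N + 1),
    2 * (2 / ρ) * Λ * K * B / √n + ε < marginGap D ρ φ y S (W w)} with hV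
  -- A sequence is exhausted by its finite initial segments, each covered by `uniform_deviation`
  -- with the same bound; continuity of measure from below passes to the limit.
  have hmono : Monotone V := by
    rintro N N' hN S ⟨w, hw⟩
    exact ⟨⟨w, by omega⟩, hw⟩
  have hunion : {S | ∃ w, 2 * (2 / ρ) * Λ * K * B / √n + ε < marginGap D ρ φ y S (W w)} =
      ⋃ N, V N := by
    ext S
    simp only [hV, Set.mem_iUnion, Set.mem_ofPred_eq]
    exact ⟨fun ⟨w, hw⟩ => ⟨w, ⟨w, by omega⟩, hw⟩, fun ⟨_, w, hw⟩ => ⟨w, hw⟩⟩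
  rw [hunion, hmono.measure_iUnion]
  refine iSup_le fun N => ?_
  have := uniform_deviation (ι := Fin (N + 1)) D hn
    (fun w z => marginLoss ρ (linOut (W w) (φ z)) (y z))
    (fun w => measurable_marginLoss_linOut hK hρ hφ hy _) (fun w z => marginLoss_nonneg _ _ _)
    (fun w z => marginLoss_le_one _ _ _) φ hφi hB hφB (fun w => W w) hΛ
    (show (0 : ℝ) ≤ 2 / ρ by positivity) (fun w k => hW w k)
    (fun z w w' => exists_abs_marginLoss_sub_le hK hρ _ _ _) hε
  rw [Fintype.card_fin] at this
  exact (ENNReal.le_ofReal_iff_toReal_le (measure_ne_top _ _) (Real.exp_pos _).le).2 this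

lemma integral_zeroOneLoss_le (hK : 2 ≤ K) {ρ : ℝ} (hρ : 0 < ρ) (D : Measure Z)
    [IsProbabilityMeasure D] {φ : Z → E} {y : Z → Fin K} (hφ : Measurable φ) (hy : Measurable y)
    {n : ℕ} (S : Fin n → Z) (W : Fin K → E) :
    ∫ z, zeroOneLoss (linOut W (φ z)) (y z) ∂D -
      (1 / (n : ℝ)) * ∑ i, marginLoss ρ (linOut W (φ (S i))) (y (S i)) ≤ marginGap D ρ φ y S W := by
  refine sub_le_sub_right (integral_mono_of_nonneg
    (Eventually.of_forall fun z => zeroOneLoss_nonneg _ _)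
    (integrable_of_abs_le (measurable_marginLoss_linOut hK hρ hφ hy W)
      fun z => abs_marginLoss_le_one _ _ _)
    (Eventually.of_forall fun z => zeroOneLoss_le_marginLoss hρ _ _)) _

end Predictors

/-! ### The network as a linear predictor on frozen features. -/

section Network

variable {H : ℕ} {m : ℕ → ℕ} {σ : ℝ → ℝ}

/-- The features seen by the output layer: the last hidden layer and the constant input of the
bias. -/
def feature (σ : ℝ → ℝ) (θ : Params H m) (x : EuclideanSpace ℝ (Fin (m 0))) :
    EuclideanSpace ℝ (Option (Fin (m H))) :=
  WithLp.toLp 2 (augment (layerOutput σ θ x H le_rfl))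

/-- The rows of the output layer. -/
def outRow (θ : Params H m) (i : Fin (m (H + 1))) : EuclideanSpace ℝ (Option (Fin (m H))) :=
  WithLp.toLp 2 fun j => θ ⟨⟨H, by omega⟩, i, j⟩

lemma netOutput_eq_linOut (θ : Params H m) (x : EuclideanSpace ℝ (Fin (m 0))) :
    netOutput σ x θ = linOut (outRow θ) (feature σ θ x) := by
  unfold netOutput linOut
  congr 1
  funext i
  rw [PiLp.inner_apply, Fintype.sum_option]
  simp [outRow, feature, augment, add_comm, mul_comm]

lemma norm_sq_feature (θ : Params H m) (x : EuclideanSpace ℝ (Fin (m 0))) :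
    ‖feature σ θ x‖ ^ 2 = 1 + ‖layerOutput σ θ x H le_rfl‖ ^ 2 := by
  rw [EuclideanSpace.real_norm_sq_eq, EuclideanSpace.real_norm_sq_eq, Fintype.sum_option]
  simp [feature, augment]

lemma lastLayerNorm_eq (θ : Params H m) : lastLayerNorm θ = ⨆ i, ‖outRow θ i‖ := by
  simp [lastLayerNorm, EuclideanSpace.norm_eq, outRow]

lemma norm_outRow_le (θ : Params H m) (i : Fin (m (H + 1))) : ‖outRow θ i‖ ≤ lastLayerNorm θ := by
  rw [lastLayerNorm_eq]
  exact le_ciSup_fin (fun i => ‖outRow θ i‖) i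

/-- Gradient descent on the output layer leaves the hidden layers unchanged. -/
lemma gradDescent_hidden (J : Params H m → ℝ) (α : ℝ) (θ₀ : Params H m) (t : ℕ)
    (k : ParamIdx H m) (hk : k.1 ≠ Fin.last H) :
    gradDescent J (lastLayerRate H m α) θ₀ t k = θ₀ k := by
  induction t with
  | zero => rfl
  | succ t ih =>
    change gradDescent J (lastLayerRate H m α) θ₀ t k - lastLayerRate H m α k * _ = _
    rw [ih]
    simp [lastLayerRate, hk]

lemma feature_gradDescent (J : Params H m → ℝ) (α : ℝ) (θ₀ : Params H m) (t : ℕ)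
    (x : EuclideanSpace ℝ (Fin (m 0))) :
    feature σ (gradDescent J (lastLayerRate H m α) θ₀ t) x = feature σ θ₀ x := by
  unfold feature
  rw [layerOutput_congr x H le_rfl fun k hk => gradDescent_hidden J α θ₀ t k fun h => by
    rw [h] at hk; simp at hk]

lemma measurable_feature (hσ : Continuous σ) :
    Measurable fun p : Params H m × EuclideanSpace ℝ (Fin (m 0)) => feature σ p.1 p.2 := by
  refine (WithLp.measurable_toLp 2 _).comp (measurable_pi_iff.2 fun o => ?_)
  cases o with
  | none => exact measurable_const
  | some j =>
    exact ((EuclideanSpace.proj j).continuous.comp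
      (continuous_layerOutput hσ H le_rfl)).measurable

lemma integrable_feature (hσ : Continuous σ) {Z : Type} [MeasurableSpace Z] (D : Measure Z)
    [IsProbabilityMeasure D] {ξ : Z → EuclideanSpace ℝ (Fin (m 0))} (hξ : Measurable ξ)
    (θ : Params H m) {c : ℝ} (hc : 0 ≤ c)
    (hθ : meanSq σ D ξ H le_rfl θ ≤ ENNReal.ofReal c) :
    Integrable (fun z => ‖feature σ θ (ξ z)‖ ^ 2) D ∧
      ∫ z, ‖feature σ θ (ξ z)‖ ^ 2 ∂D ≤ √(1 + c) ^ 2 := by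
  have hm : Measurable fun z => ‖layerOutput σ θ (ξ z) H le_rfl‖ ^ 2 :=
    ((measurable_layerOutput_comp hσ hξ H le_rfl).comp measurable_prodMk_left).norm.pow_const 2
  have hlt : ∫⁻ z, ENNReal.ofReal (‖layerOutput σ θ (ξ z) H le_rfl‖ ^ 2) ∂D < ∞ :=
    lt_of_le_of_lt hθ ENNReal.ofReal_lt_top
  have hi : Integrable (fun z => ‖layerOutput σ θ (ξ z) H le_rfl‖ ^ 2) D :=
    ⟨hm.aestronglyMeasurable, (hasFiniteIntegral_iff_ofReal
      (Eventually.of_forall fun z => sq_nonneg _)).2 hlt⟩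
  simp_rw [norm_sq_feature]
  refine ⟨(integrable_const 1).add hi, ?_⟩
  rw [integral_add (integrable_const 1) hi, Real.sq_sqrt (by linarith)]
  simp only [integral_const, probReal_univ, smul_eq_mul, mul_one]
  gcongr
  rw [integral_eq_lintegral_of_nonneg_ae (Eventually.of_forall fun z => sq_nonneg _)
    hm.aestronglyMeasurable]
  exact ENNReal.toReal_le_of_le_ofReal hc hθ

end Network

end MarginBound

/-! ### Generalization of the last-layer gradient descent -/

namespace MarginBound

open scoped ENNReal NNReal

lemma tsum_ofReal_div_pi_sq {δ : ℝ} (hδ : 0 ≤ δ) :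
    ∑' k : ℕ, ENNReal.ofReal (δ / (Real.pi ^ 2 * ((k + 1 : ℕ) : ℝ) ^ 2)) =
      ENNReal.ofReal (δ / 6) := by
  have h1 : HasSum (fun k : ℕ => 1 / ((k + 1 : ℕ) : ℝ) ^ 2) (Real.pi ^ 2 / 6) := by
    have := (hasSum_nat_add_iff' 1).2 hasSum_zeta_two
    simpa using this
  have h2 : HasSum (fun k : ℕ => δ / (Real.pi ^ 2 * ((k + 1 : ℕ) : ℝ) ^ 2)) (δ / 6) := by
    have h3 := h1.mul_left (δ / Real.pi ^ 2)
    simp_rw [div_mul_div_comm, mul_one] at h3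
    rwa [mul_comm (Real.pi ^ 2), mul_div_mul_right _ _ (by positivity)] at h3
  rw [← ENNReal.ofReal_tsum_of_nonneg (fun k => by positivity) h2.summable, h2.tsum_eq]

/-! ### Simultaneous control of all linear predictors. -/

section Event

variable {Θ Z E : Type*} [MeasurableSpace Θ] [MeasurableSpace Z] [NormedAddCommGroup E]
  [InnerProductSpace ℝ E] [MeasurableSpace E] [BorelSpace E] {K n : ℕ}

lemma measurable_marginGap (hK : 2 ≤ K) {ρ : ℝ} (hρ : 0 < ρ) (D : Measure Z)
    [IsProbabilityMeasure D] {φ : Θ → Z → E} {y : Z → Fin K} (hφ : Measurable (Function.uncurry φ))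
    (hy : Measurable y) (W : Fin K → E) :
    Measurable fun p : Θ × (Fin n → Z) => marginGap D ρ (φ p.1) y p.2 W := by
  have h : Measurable fun p : Θ × Z => marginLoss ρ (linOut W (φ p.1 p.2)) (y p.2) :=
    measurable_marginLoss_linOut hK hρ hφ (hy.comp measurable_snd) W
  refine Measurable.sub ?_ (measurable_const.mul (Finset.measurable_sum _ fun i _ => ?_))
  · exact (h.stronglyMeasurable.integral_prod_right' (ν := D)).measurable.comp measurable_fst
  · exact h.comp (measurable_fst.prodMk ((measurable_pi_apply i).comp measurable_snd))

/-- The uniform deviation bound for the margin losses of all linear predictors on random features,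
with a union bound over the integers that round up the scaled norm. -/
lemma exists_marginGap_event [SecondCountableTopology E] (hK : 2 ≤ K) {ρ : ℝ} (hρ : 0 < ρ) (hn : 1 ≤ n) (μ : Measure Θ)
    [IsProbabilityMeasure μ] (D : Measure Z) [IsProbabilityMeasure D] {φ : Θ → Z → E}
    {y : Z → Fin K} (hφ : Measurable (Function.uncurry φ)) (hy : Measurable y) {G : Set Θ}
    (hG : MeasurableSet G) {B : ℝ} (hB : 0 < B)
    (hGi : ∀ θ ∈ G, Integrable (fun z => ‖φ θ z‖ ^ 2) D ∧ ∫ z, ‖φ θ z‖ ^ 2 ∂D ≤ B ^ 2)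
    {ς δ : ℝ} (hς : 0 < ς) (hδ : 0 < δ) (hδ1 : δ ≤ 1) :
    ∃ A : Set (Θ × (Fin n → Z)), MeasurableSet A ∧
      (μ.prod (Measure.pi fun _ : Fin n => D)) Aᶜ ≤ μ Gᶜ + ENNReal.ofReal (δ / 6) ∧
      ∀ p ∈ A, ∀ (k : ℕ) (W : Fin K → E), k ≠ 0 → (∀ i, ‖W i‖ ≤ k / ς) →
        marginGap D ρ (φ p.1) y p.2 W ≤ 2 * (2 / ρ) * (k / ς) * K * B / √n +
          √(Real.log (Real.pi ^ 2 * (k : ℝ) ^ 2 / δ) / (2 * n)) := by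
  set P : Measure (Fin n → Z) := Measure.pi fun _ : Fin n => D with hP
  set ε : ℕ → ℝ := fun k => √(Real.log (Real.pi ^ 2 * (k : ℝ) ^ 2 / δ) / (2 * n)) with hε
  set b : ℕ → ℝ := fun k => 2 * (2 / ρ) * (k / ς) * K * B / √n + ε k with hb
  let R : ℕ → Set (Fin K → E) := fun k => {W | ∀ i, ‖W i‖ ≤ k / ς}
  have hR : ∀ k, Nonempty (R k) := fun k => ⟨⟨0, fun i => by
    simp only [Pi.zero_apply, norm_zero]; positivity⟩⟩
  -- A dense sequence in each set of weights keeps the bad events measurable and reduces them to the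
  -- countable case.
  let w : (k : ℕ) → ℕ → R k := fun k => TopologicalSpace.denseSeq (R k)
  let V : ℕ → Set (Θ × (Fin n → Z)) := fun k =>
    {p | ∃ i, b k < marginGap D ρ (φ p.1) y p.2 (w k i)}
  have hV : ∀ k, MeasurableSet (V k) := fun k => by
    have : V k = ⋃ i, {p | b k < marginGap D ρ (φ p.1) y p.2 (w k i)} := by
      ext p; simp [V]
    rw [this]
    exact MeasurableSet.iUnion fun i =>
      measurableSet_lt measurable_const (measurable_marginGap hK hρ D hφ hy _)
  -- The radicand is chosen so that McDiarmid's failure probability is the summable share `δ / (π²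
  -- k²)`.
  have hexp : ∀ k : ℕ, k ≠ 0 →
      Real.exp (-(2 * n * ε k ^ 2)) = δ / (Real.pi ^ 2 * (k : ℝ) ^ 2) := fun k hk => by
    have hk1 : (1 : ℝ) ≤ k := by exact_mod_cast Nat.one_le_iff_ne_zero.2 hk
    have hn0 : (0 : ℝ) < n := by exact_mod_cast hn
    have hpi : 1 ≤ Real.pi := by linarith [Real.pi_gt_three]
    have h1 : 1 ≤ Real.pi ^ 2 * (k : ℝ) ^ 2 / δ :=
      (one_le_div hδ).2 (hδ1.trans (one_le_mul_of_one_le_of_one_le (one_le_pow₀ hpi)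
        (one_le_pow₀ hk1)))
    rw [hε, Real.sq_sqrt (div_nonneg (Real.log_nonneg h1) (by positivity)),
      mul_div_cancel₀ _ (by positivity), Real.exp_neg, Real.exp_log (by linarith), inv_div]
  have hVG : ∀ k, k ≠ 0 → (μ.prod P) (V k ∩ G ×ˢ Set.univ) ≤
      ENNReal.ofReal (δ / (Real.pi ^ 2 * (k : ℝ) ^ 2)) := fun k hk => by
    rw [Measure.prod_apply ((hV k).inter (hG.prod MeasurableSet.univ))]
    calc ∫⁻ θ, P (Prod.mk θ ⁻¹' (V k ∩ G ×ˢ Set.univ)) ∂μ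
        ≤ ∫⁻ _, ENNReal.ofReal (δ / (Real.pi ^ 2 * (k : ℝ) ^ 2)) ∂μ := lintegral_mono fun θ => ?_
      _ = _ := by simp
    by_cases hθ : θ ∈ G
    · rw [← hexp k hk]
      refine (measure_mono ?_).trans (measure_exists_marginGap_gt_le hK hρ D
        (hφ.comp measurable_prodMk_left) hy hn (hGi θ hθ).1 hB (hGi θ hθ).2
        (fun i => (w k i : Fin K → E)) (show (0 : ℝ) ≤ k / ς by positivity)
        (fun i => (w k i).2) (Real.sqrt_nonneg _))
      rintro S ⟨hS, -⟩
      exact hS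
    · have : Prod.mk θ ⁻¹' (V k ∩ G ×ˢ Set.univ) = ∅ := by
        ext S; simp [hθ]
      simp [this]
  refine ⟨G ×ˢ Set.univ \ ⋃ k, V (k + 1), (hG.prod MeasurableSet.univ).diff
    (MeasurableSet.iUnion fun k => hV _), ?_, ?_⟩
  · calc (μ.prod P) (G ×ˢ Set.univ \ ⋃ k, V (k + 1))ᶜ
        ≤ (μ.prod P) (Gᶜ ×ˢ Set.univ ∪ ⋃ k, (V (k + 1) ∩ G ×ˢ Set.univ)) := by
          refine measure_mono fun p hp => ?_
          by_cases hpG : p.1 ∈ G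
          · right
            simp only [Set.mem_compl_iff, Set.mem_sdiff, Set.mem_prod, hpG, Set.mem_univ, and_self,
              true_and, not_not, Set.mem_iUnion] at hp
            obtain ⟨k, hk⟩ := hp
            exact Set.mem_iUnion.2 ⟨k, hk, hpG, trivial⟩
          · exact Or.inl ⟨hpG, trivial⟩
      _ ≤ (μ.prod P) (Gᶜ ×ˢ Set.univ) + ∑' k, (μ.prod P) (V (k + 1) ∩ G ×ˢ Set.univ) :=
          (measure_union_le _ _).trans (by gcongr; exact measure_iUnion_le _)
      _ ≤ μ Gᶜ + ∑' k : ℕ, ENNReal.ofReal (δ / (Real.pi ^ 2 * ((k + 1 : ℕ) : ℝ) ^ 2)) := by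
          gcongr with k
          · simp [Measure.prod_prod]
          · exact hVG (k + 1) (Nat.succ_ne_zero k)
      _ = _ := by rw [tsum_ofReal_div_pi_sq hδ.le]
  · rintro p ⟨hpG, hpV⟩ k W hk hW
    obtain ⟨k, rfl⟩ := Nat.exists_eq_succ_of_ne_zero hk
    have hc : Continuous fun W : R (k + 1) => marginGap D ρ (φ p.1) y p.2 W :=
      (continuous_marginGap hK hρ D (hφ.comp measurable_prodMk_left) hy p.2).comp
        continuous_subtype_val
    -- The gap is continuous in the weights, so the bound passes from the dense sequence to every
    -- `W`.
    refine (TopologicalSpace.denseRange_denseSeq (R (k + 1))).induction_on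
      (p := fun W : R (k + 1) => marginGap D ρ (φ p.1) y p.2 W ≤ b (k + 1)) ⟨W, hW⟩
      (isClosed_le hc continuous_const) fun i => ?_
    by_contra hi
    exact hpV (Set.mem_iUnion.2 ⟨k, i, not_le.1 hi⟩)

end Event

section Network

variable {H n : ℕ} {m : ℕ → ℕ} {σ : ℝ → ℝ}

lemma norm_outRow_le_ceil_div (θ : Params H m) {ς : ℝ} (hς : 0 < ς) (i : Fin (m (H + 1))) :
    ‖outRow θ i‖ ≤ (⌈ς * lastLayerNorm θ⌉₊ : ℝ) / ς := by
  rw [le_div_iff₀' hς]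
  exact (mul_le_mul_of_nonneg_left (norm_outRow_le θ i) hς.le).trans (Nat.le_ceil _)

/-- If the output layer vanishes, then both losses are one. -/
lemma integral_zeroOneLoss_sub_eq_zero (hK : 2 ≤ m (H + 1)) (hn : 1 ≤ n)
    (D : Measure (EuclideanSpace ℝ (Fin (m 0)) × Fin (m (H + 1)))) [IsProbabilityMeasure D] (ρ : ℝ)
    {ς : ℝ} (hς : 0 < ς) (S : Fin n → EuclideanSpace ℝ (Fin (m 0)) × Fin (m (H + 1)))
    (θ : Params H m) (h0 : ⌈ς * lastLayerNorm θ⌉₊ = 0) :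
    (∫ z, zeroOneLoss (netOutput σ z.1 θ) z.2 ∂D) -
      (1 / (n : ℝ)) * ∑ i, marginLoss ρ (netOutput σ (S i).1 θ) (S i).2 = 0 := by
  have hrow : ∀ i, outRow θ i = 0 := fun i => by
    have := norm_outRow_le_ceil_div θ hς i
    rw [h0] at this
    simpa using this
  have hout : ∀ x, netOutput σ x θ = 0 := fun x => by
    rw [netOutput_eq_linOut]
    ext i
    simp [linOut, hrow]
  have hn0 : (n : ℝ) ≠ 0 := by exact_mod_cast (by omega : n ≠ 0)
  simp [hout, zeroOneLoss_zero hK, marginLoss_zero, hn0]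

end Network

end MarginBound

open MarginBound

theorem proposition1 (σ : ℝ → ℝ) (hσ : IsActivation σ) (cw cb : NNReal) (C : ℝ) (hC : 0 < C) :
    ∃ c : ℕ → ℝ, (∀ H, 0 < c H) ∧
      ((cw < 2 ∨ BddAbove (Set.range σ)) → ∀ H H' : ℕ, c H = c H') ∧
      ∀ (H n : ℕ) (m : ℕ → ℕ) (δ : ℝ), 2 ≤ H → 1 ≤ n → 0 < δ →
        -- the architecture
        2 ≤ m (H + 1) →
        (∀ l : ℕ, 1 ≤ l → l ≤ H - 2 →
          C * (H : ℝ) ^ 2 * Real.log ((H : ℝ) * (n : ℝ) ^ 2 / δ) ≤ (m l : ℝ)) →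
        C * Real.log ((H : ℝ) * (n : ℝ) ^ 2 / δ) ≤ (m (H - 1) : ℝ) →
        C * (n : ℝ) ≤ (m H : ℝ) →
        -- the data distribution, the training loss, and the learning rate
        ∀ (D : Measure (EuclideanSpace ℝ (Fin (m 0)) × Fin (m (H + 1)))) [IsProbabilityMeasure D],
          (∀ᵐ z ∂D, ‖z.1‖ = 1) →
        ∀ (ℓ : EuclideanSpace ℝ (Fin (m (H + 1))) → EuclideanSpace ℝ (Fin (m (H + 1))) → ℝ)
          (ζ cz : ℝ), 0 < ζ → 0 < cz → IsLossCriterion ℓ ζ →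
        ∀ ρ ς δ' : ℝ, 0 < ρ → 1 ≤ ς → 0 < δ' →
          HoldsWithProb ((initLaw H m cw cb).prod (Measure.pi fun _ : Fin n => D)) (1 - δ - δ')
            fun ω => ∀ t : ℕ,
              let θ : Params H m := gradDescent (trainObjective σ ℓ ω.2)
                (lastLayerRate H m (1 / (cz * ζ))) ω.1 t
              (∫ z, zeroOneLoss (netOutput σ z.1 θ) z.2 ∂D) -
                  (1 / (n : ℝ)) * ∑ i, marginLoss ρ (netOutput σ (ω.2 i).1 θ) (ω.2 i).2 ≤
                c H * (m (H + 1) : ℝ) ^ 2 * (⌈ς * lastLayerNorm θ⌉₊ : ℝ) / (ρ * ς * √(n : ℝ)) +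
                  √(Real.log (Real.pi ^ 2 * (⌈ς * lastLayerNorm θ⌉₊ : ℝ) ^ 2 / δ') /
                    (2 * (n : ℝ))) := by
  obtain ⟨a, ha, hac, hmain⟩ := exists_meanSq_bound hσ cw cb hC
  -- Four is two from symmetrization times the Lipschitz factor two; the root bounds the feature
  -- norm in mean square, its one being the constant input of the bias.
  refine ⟨fun H => 4 * √(1 + a H), fun H => ?_, fun h H H' => ?_, ?_⟩
  · have := ha H
    positivity
  · simp only [hac h H H']
  intro H n m δ hH hn hδ hK hl hl1 hmH D _ hD ℓ ζ cz _ _ _ ρ ς δ' hρ hς1 hδ'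
  have hσc : Continuous σ := hσ.lipschitz.continuous
  have hn0 : (0 : ℝ) < n := by exact_mod_cast hn
  have hς : 0 < ς := by linarith
  have hK0 : (0 : ℝ) ≤ m (H + 1) := Nat.cast_nonneg _
  have hB : 0 < √(1 + a H) := Real.sqrt_pos.2 (by linarith [ha H])
  by_cases hδ1 : 1 ≤ δ + δ'
  · exact ⟨∅, MeasurableSet.empty, by rw [ENNReal.ofReal_of_nonpos (by linarith)]; simp, by simp⟩
  push Not at hδ1
  -- For such small `δ'` the logarithm is at least `2n` whenever the ceiling is nonzero. The square
  -- root then exceeds one, hence any gap of the losses, for every outcome.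
  by_cases hsmall : δ' < Real.pi ^ 2 * Real.exp (-(2 * n))
  · refine ⟨Set.univ, MeasurableSet.univ, ?_, fun ω _ t => ?_⟩
    · rw [measure_univ]
      exact ENNReal.ofReal_le_one.2 (by linarith)
    intro θ
    -- A zero ceiling forces a zero output layer; since ties count as errors, both losses equal one
    -- and the left side vanishes.
    by_cases h0 : ⌈ς * lastLayerNorm θ⌉₊ = 0
    · rw [integral_zeroOneLoss_sub_eq_zero hK hn D ρ hς ω.2 θ h0]
      positivity
    simp_rw [netOutput_eq_linOut]
    have hφ : Measurable fun z : EuclideanSpace ℝ (Fin (m 0)) × Fin (m (H + 1)) =>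
        feature σ θ z.1 := (measurable_feature hσc).comp (measurable_const.prodMk measurable_fst)
    refine (integral_zeroOneLoss_le hK hρ D hφ measurable_snd ω.2 (outRow θ)).trans
      ((marginGap_le_one D ρ _ _ ω.2 _).trans ?_)
    refine le_add_of_nonneg_of_le (by positivity) (Real.one_le_sqrt.2 ?_)
    rw [one_le_div (by positivity), Real.le_log_iff_exp_le (by positivity), le_div_iff₀ hδ']
    have hk1 : (1 : ℝ) ≤ (⌈ς * lastLayerNorm θ⌉₊ : ℝ) ^ 2 :=
      one_le_pow₀ (by exact_mod_cast Nat.one_le_iff_ne_zero.2 h0)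
    calc Real.exp (2 * n) * δ' ≤ Real.exp (2 * n) * (Real.pi ^ 2 * Real.exp (-(2 * n))) := by
          gcongr
      _ = Real.pi ^ 2 * 1 := by
          rw [mul_left_comm, ← Real.exp_add, add_neg_cancel, Real.exp_zero]
      _ ≤ _ := by gcongr
  push Not at hsmall
  have hG : MeasurableSet {θ : Params H m |
      meanSq σ D Prod.fst H le_rfl θ ≤ ENNReal.ofReal (a H)} :=
    measurableSet_le (measurable_meanSq hσc D measurable_fst _ _) measurable_const
  obtain ⟨A, hA, hAμ, hAgap⟩ := exists_marginGap_event (n := n) hK hρ hn (initLaw H m cw cb) D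
    (φ := fun θ z => feature σ θ z.1) (y := Prod.snd)
    ((measurable_feature hσc).comp
      (measurable_fst.prodMk (measurable_fst.comp measurable_snd)))
    measurable_snd hG hB
    (fun θ hθ => integrable_feature hσc D measurable_fst θ (ha H).le hθ) hς hδ' (by linarith)
  refine ⟨A, hA, ?_, fun ω hω t => ?_⟩
  · have hbad := hmain H n m δ hH hn hδ (by linarith) hl hl1 hmH _ D Prod.fst measurable_fst hD
    have hpi : (9 : ℝ) ≤ Real.pi ^ 2 := by nlinarith [Real.pi_gt_three]
    -- The total failure probability is then at most `δ + δ'/9 + δ'/6`, below `δ + δ'`.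
    have hexp : Real.exp (-(2 * n)) ≤ δ' / 9 := by
      rw [le_div_iff₀ (by norm_num)]
      nlinarith [Real.exp_pos (-(2 * (n : ℝ)))]
    have hcompl : ((initLaw H m cw cb).prod (Measure.pi fun _ : Fin n => D)) Aᶜ ≤
        ENNReal.ofReal (δ + δ') := by
      refine hAμ.trans ?_
      have h1 : initLaw H m cw cb {θ : Params H m |
          meanSq σ D Prod.fst H le_rfl θ ≤ ENNReal.ofReal (a H)}ᶜ ≤
          ENNReal.ofReal δ + ENNReal.ofReal (Real.exp (-(2 * n))) := by
        refine le_trans (measure_mono fun θ hθ => ?_) hbad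
        simpa using hθ
      refine (add_le_add_left h1 _).trans ?_
      rw [← ENNReal.ofReal_add hδ.le (Real.exp_pos _).le,
        ← ENNReal.ofReal_add (by positivity) (by positivity)]
      exact ENNReal.ofReal_le_ofReal (by linarith)
    rw [← compl_compl A, prob_compl_eq_one_sub hA.compl, sub_sub,
      ENNReal.ofReal_sub _ (by positivity), ENNReal.ofReal_one]
    exact tsub_le_tsub_left hcompl _
  intro θ
  by_cases h0 : ⌈ς * lastLayerNorm θ⌉₊ = 0
  · rw [integral_zeroOneLoss_sub_eq_zero hK hn D ρ hς ω.2 θ h0]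
    positivity
  have hfeat : ∀ x, feature σ θ x = feature σ ω.1 x := feature_gradDescent _ _ _ _
  simp_rw [netOutput_eq_linOut, hfeat]
  have hφ : Measurable fun z : EuclideanSpace ℝ (Fin (m 0)) × Fin (m (H + 1)) =>
      feature σ ω.1 z.1 := (measurable_feature hσc).comp (measurable_const.prodMk measurable_fst)
  refine (integral_zeroOneLoss_le hK hρ D hφ measurable_snd ω.2 (outRow θ)).trans
    ((hAgap ω hω _ (outRow θ) h0 (norm_outRow_le_ceil_div θ hς)).trans ?_)
  refine add_le_add_left ?_ _
  -- The argument gives a factor `m_y`, which is weakened here to `m_y²`.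
  have hKK : (m (H + 1) : ℝ) ≤ (m (H + 1) : ℝ) ^ 2 := by
    have : (2 : ℝ) ≤ m (H + 1) := by exact_mod_cast hK
    nlinarith
  have heq : 2 * (2 / ρ) * ((⌈ς * lastLayerNorm θ⌉₊ : ℝ) / ς) * (m (H + 1) : ℝ) * √(1 + a H) / √n =
      4 * √(1 + a H) * (m (H + 1) : ℝ) * (⌈ς * lastLayerNorm θ⌉₊ : ℝ) / (ρ * ς * √n) := by
    have : √(n : ℝ) ≠ 0 := (Real.sqrt_pos.2 hn0).ne'
    field_simp
    ring
  rw [heq]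
  gcongr

end
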